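/- **Definitions.** Let $G$ be an at most countable additive (abelian) group. Finite multisets in $G$ are summed and averaged over with multiplicity: $A+B=\{a+b : a\in A,\ b\in B\}$ counted with multiplicity, and $\mathbb{E}_{a\in A}F(a)=\frac1{|A|}\sum_{a\in A}F(a)$. A *$G$-system* $(\mathrm X,T)$ is a probability space $\mathrm X=(X,\mathcal B,\mu)$, countably generated modulo null sets (equivalently, with $L^2(\mathrm X)$ separable), with invertible measure-preserving maps $T^g\colon X\to X$, $g\in G$, such that $T^0=\mathrm{id}$ and $T^{g+h}=T^gT^h$. Write $T^gf=f\circ T^{-g}$, $\langle f,g\rangle=\int_X f\overline g\,d\mu$, and $\Delta_{h,h'}f=(T^hf)\overline{(T^{h'}f)}$. For $d\ge 1$, non-empty finite multisets $Q_1,\dots,Q_d$ in $G$ and $f\in L^\infty(\mathrm X)$, the Gowers box norm $\|f\|_{\Box^d_{Q_1,\dots,Q_d}(\mathrm X)}\ge 0$ is defined by $$\|f\|_{\Box^d_{Q_1,\dots,Q_d}(\mathrm X)}^{2^d}=\mathbb{E}_{h_i,h_i'\in Q_i\ \forall i=1,\dots,d}\int_X\Delta_{h_1,h_1'}\cdots\Delta_{h_d,h_d'}f\,d\mu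 .$$ A *coset progression* of rank $r\ge 0$ in $G$ is a multiset $$Q=H+\{n_1v_1+\dots+n_rv_r : n_i\in\mathbb Z,\ |n_i|\le N_i\ \text{for all } i\},$$ where $H$ is a finite subgroup of $G$ (viewed as a multiset all of whose elements have the same positive multiplicity), $v_1,\dots,v_r\in G$, and $N_1,\dots,N_r>0$ are real; the data $H$, $r$, $v_i$, $N_i$ are part of $Q$. For $\varepsilon>0$ the dilate $\varepsilon Q$ is obtained by replacing each $N_i$ by $\varepsilon N_i$. If $Q,Q'$ are coset progressions of ranks $r,r'$, then $Q+Q'$ is a coset progression of rank $r+r'$ (sum the subgroups as multisets and concatenate the generators and the $N_i$). For coset progressions $Q_1,\dots,Q_d$ and $\varepsilon>0$ put $$\|f\|_{\Box^d_{Q_1,\dots,Q_d}(\mathrm X)^*,\varepsilon}=\sup\{|\langle f,g\rangle| : g\in L^\infty(\mathrm X),\ \|g\|_{L^\infty(\mathrm X)}\le 1,\ \|g\|_{\Box^d_{\varepsilon Q_1,\dots,\varepsilon Q_d}(\mathrm X)}\le\varepsilon\}.$$ **Theorem.** Let $d_1,d_2$ be positive integers, let $r_{1,1},\dots,r_{1,d_1},r_{2,1},\dots,r_{2,d_2}$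 be non-negative integers, and let $c_1,c_2\colon(0,\infty)\to(0,\infty)$ be functions with $c_i(\varepsilon)\to 0$ as $\varepsilon\to 0$ for $i=1,2$. Then there exists a function $c\colon(0,\infty)\to(0,\infty)$ with $c(\varepsilon)\to 0$ as $\varepsilon\to 0$, depending only on $d_1,d_2,c_1,c_2$ and the $r_{i,j}$, such that the following holds. Let $G$ be an at most countable additive group, let $Q_{i,j}$ be a coset progression of rank $r_{i,j}$ in $G$ for $i=1,2$ and $1\le j\le d_i$, let $(\mathrm X,T)$ be a $G$-system, and let $f$ lie in the closed unit ball of $L^\infty(\mathrm X)$. If $$\|f\|_{\Box^{d_1}_{Q_{1,1},\dots,Q_{1,d_1}}(\mathrm X)^*,\varepsilon}\le c_1(\varepsilon)\quad\text{and}\quad\|f\|_{\Box^{d_2}_{Q_{2,1},\dots,Q_{2,d_2}}(\mathrm X)^*,\varepsilon}\le c_2(\varepsilon)\qquad\text{for all }\varepsilon>0,$$ then $$\|f\|_{\Box^{d_1d_2}_{(Q_{1,i}+Q_{2,j})_{1\le i\le d_1,\,1\le j\le d_2}}(\mathrm X)^*,\varepsilon}\le c(\varepsilon)\qquad\text{for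 all }\varepsilon>0.$$ -/

import Mathlib

open MeasureTheory Filter Topology
open scoped ENNReal ComplexConjugate

noncomputable section

namespace BoxConcat

/-- The sumset `A + B` of two finite multisets, counted with multiplicity. -/
def sumset {G : Type*} [Add G] (A B : Multiset G) : Multiset G :=
  (A ×ˢ B).map fun p => p.1 + p.2

/-- The average of `F` over a finite multiset, counted with multiplicity. -/
def avg {G : Type*} (A : Multiset G) (F : G → ℂ) : ℂ :=
  (A.map F).sum / (A.card : ℂ)

/-- The integer tuples `n` with `|n i| ≤ N i` for all `i`, for nonnegative real numbers `N i`. -/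
def intBox {r : ℕ} (N : Fin r → ℝ) : Finset (Fin r → ℤ) :=
  Fintype.piFinset fun i => Finset.Icc (-⌊N i⌋) ⌊N i⌋

/-- The data of a (symmetric) coset progression in `G`. -/
structure CosetProgression (G : Type*) [AddCommGroup G] where
  /-- the finite subgroup -/
  H : AddSubgroup G
  finite_H : Finite H
  /-- the common multiplicity with which the elements of `H` are counted -/
  mult : ℕ
  mult_pos : 0 < mult
  rank : ℕ
  /-- the generators -/
  v : Fin rank → G
  /-- the (real) dimensions -/
  N : Fin rank → ℝ
  N_pos : ∀ i, 0 < N i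

namespace CosetProgression

variable {G : Type*} [AddCommGroup G]

/-- The subgroup `H` as a multiset, each element being counted `mult` times. -/
def torsion (Q : CosetProgression G) : Multiset G :=
  haveI := Q.finite_H
  Q.mult • (Set.toFinite (Q.H : Set G)).toFinset.val

/-- The dilate `ε Q`, the multiset `H + {n₁ v₁ + ⋯ + n_r v_r : |n_i| ≤ ε N_i}`.
The multiset underlying `Q` is the dilate with `ε = 1`. -/
def dilate (ε : ℝ) (Q : CosetProgression G) : Multiset G :=
  sumset Q.torsion ((intBox fun i => ε * Q.N i).val.map fun n => ∑ i, n i • Q.v i)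

theorem finite_sup {H K : AddSubgroup G} (hH : Finite H) (hK : Finite K) :
    Finite (H ⊔ K : AddSubgroup G) := by
  have : ((H ⊔ K : AddSubgroup G) : Set G).Finite := by
    rw [AddSubgroup.add_normal H K]
    exact Set.Finite.add (Set.toFinite _) (Set.toFinite _)
  exact this

/-- The sum `Q + R`, a coset progression of rank `Q.rank + R.rank`: the subgroup is `H_Q + H_R`
(an element of which is a sum of elements of `H_Q` and `H_R` in `|H_Q ∩ H_R|` ways), and the
generators and dimensions are concatenated. -/
def add (Q R : CosetProgression G) : CosetProgression G where
  H := Q.H ⊔ R.H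
  finite_H := finite_sup Q.finite_H R.finite_H
  mult := Q.mult * R.mult * Nat.card (Q.H ⊓ R.H : AddSubgroup G)
  mult_pos := by
    have := Q.finite_H
    have : Finite (Q.H ⊓ R.H : AddSubgroup G) :=
      Finite.of_injective (AddSubgroup.inclusion (inf_le_left : Q.H ⊓ R.H ≤ Q.H))
        (AddSubgroup.inclusion_injective _)
    exact Nat.mul_pos (Nat.mul_pos Q.mult_pos R.mult_pos) Nat.card_pos
  rank := Q.rank + R.rank
  v := Fin.append Q.v R.v
  N := Fin.append Q.N R.N
  N_pos := by
    intro i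
    refine Fin.addCases (fun j => ?_) (fun j => ?_) i
    · simpa using Q.N_pos j
    · simpa using R.N_pos j

instance : Add (CosetProgression G) := ⟨add⟩

end CosetProgression

section System

variable {G X : Type*} [AddCommGroup G] [AddAction G X]

/-- The translate `T^g f = f ∘ T^{-g}` of a function. -/
def shift (g : G) (f : X → ℂ) : X → ℂ := fun x => f (-g +ᵥ x)

/-- The nonlinear operator `Δ_{h,h'} f = (T^h f) · conj (T^{h'} f)`. -/
def delta (h h' : G) (f : X → ℂ) : X → ℂ := fun x => shift h f x * conj (shift h' f x)

variable [MeasurableSpace X]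

/-- The average over `h_i, h'_i ∈ Q_i` (`i = 1, …, d`) of `∫ Δ_{h_1,h'_1} ⋯ Δ_{h_d,h'_d} f dμ`,
i.e. the `2^d`-th power of the Gowers box norm. -/
def boxPow (μ : Measure X) : (d : ℕ) → (Fin d → Multiset G) → (X → ℂ) → ℂ
  | 0, _, f => ∫ x, f x ∂μ
  | d + 1, Q, f =>
      avg (Q (Fin.last d)) fun h => avg (Q (Fin.last d)) fun h' =>
        boxPow μ d (fun i => Q i.castSucc) (delta h h' f)

/-- The Gowers box (semi-)norm along the multisets `Q_1, …, Q_d`. For `d ≥ 1` the complex number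
`boxPow μ d Q f` is real and nonnegative, hence equal to its absolute value. -/
def boxNorm (μ : Measure X) {d : ℕ} (Q : Fin d → Multiset G) (f : X → ℂ) : ℝ :=
  ‖boxPow μ d Q f‖ ^ (1 / (2 : ℝ) ^ d)

/-- `f` lies in the closed unit ball of `L^∞(μ)`. -/
def InUnitBall (μ : Measure X) (f : X → ℂ) : Prop :=
  AEStronglyMeasurable f μ ∧ eLpNorm f ∞ μ ≤ 1

/-- The dual quantity: the supremum of `|⟨f, g⟩|` over all `g` in the closed unit ball of `L^∞`
whose box norm along the dilates `ε Q_1, …, ε Q_d` is at most `ε`. -/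
def dualBoxNorm (μ : Measure X) {d : ℕ} (Q : Fin d → CosetProgression G) (ε : ℝ) (f : X → ℂ) :
    ℝ :=
  sSup {t : ℝ | ∃ g : X → ℂ, InUnitBall μ g ∧
    boxNorm μ (fun i => (Q i).dilate ε) g ≤ ε ∧ t = ‖∫ x, f x * conj (g x) ∂μ‖}

end System

/-- The family `(Q_i + R_j)_{i, j}`, listed in lexicographic order. -/
def sumFamily {G : Type*} [AddCommGroup G] {d₁ d₂ : ℕ} (Q : Fin d₁ → CosetProgression G)
    (R : Fin d₂ → CosetProgression G) : Fin (d₁ * d₂) → CosetProgression G :=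
  fun k => Q (finProdFinEquiv.symm k).1 + R (finProdFinEquiv.symm k).2

end BoxConcat

end

/-! Let `g` be bounded with `|⟨f, g⟩| ≥ δ`; the point is to bound its box norm along the sums `Q₁ᵢ +
Q₂ⱼ` from below. An energy argument (`exists_almost_minimizer`) produces `u`, anti-uniform along
`Q₂`, such that `g - u` is almost orthogonal to every function of comparable or slightly worse
anti-uniformity along `Q₂`. One such function is `f`, so `⟨f, u⟩` is still large, and
anti-uniformity of `f` along `Q₁` forces `u` to have a large box norm along `Q₁`. Equivalently, `u`
correlates with an average `V` over `Q₁`-cubes of products of translates of `u` and its conjugate.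
Anti-uniformity survives products and averages (`AntiUniform.prod`, `AntiUniform.avg`), so `V` is
almost orthogonal to `g - u` too, and `g` itself correlates with `V`.

Each factor of `V` can now be traded for a dual function along `Q₂` (`exists_isDual_replacement`):
whatever an anti-uniform function correlates with has a large box norm, hence correlates with a dual
function. So `g` correlates with an average over `Q₁`-cubes of products of translated `Q₂`-dual
functions. The factors of this average are grouped by pairs `(i, j)`; the group `(i, j)` is
unchanged when the point moves by `q₁ + q₂` while the `i`-th cube parameter moves by `q₁` and the
`j`-th dual parameters move by `q₂`. Averages over progressions hardly notice translations from much
smaller dilates, so Gowers–Cauchy–Schwarz with one direction per pair bounds the correlation by the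
desired box norm (`norm_avg_integral_cube_isDual_le`). All constants depend only on `δ`, the moduli,
the dimensions and a bound for the ranks. -/

namespace BoxConcat

/-! ### Averages over finite multisets. -/

section Averages

variable {α β K : Type*}

/-- The average of a real function over a finite multiset. -/
noncomputable def avgR (A : Multiset α) (F : α → ℝ) : ℝ :=
  (A.map F).sum / (A.card : ℝ)

theorem avg_const {A : Multiset α} (hA : A ≠ 0) (z : ℂ) : avg A (fun _ => z) = z := by
  have : (A.card : ℂ) ≠ 0 := by simpa using hA
  simp [avg, this]

theorem avg_add (A : Multiset α) (F F' : α → ℂ) :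
    avg A (fun a => F a + F' a) = avg A F + avg A F' := by
  simp [avg, Multiset.sum_map_add, add_div]

theorem avg_sub (A : Multiset α) (F F' : α → ℂ) :
    avg A (fun a => F a - F' a) = avg A F - avg A F' := by
  simp [avg, Multiset.sum_map_sub, sub_div]

theorem avg_mul_left (A : Multiset α) (z : ℂ) (F : α → ℂ) :
    avg A (fun a => z * F a) = z * avg A F := by
  simp [avg, Multiset.sum_map_mul_left, mul_div_assoc]

theorem avg_mul_right (A : Multiset α) (z : ℂ) (F : α → ℂ) :
    avg A (fun a => F a * z) = avg A F * z := by
  simp [mul_comm _ z, avg_mul_left]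

theorem avg_conj (A : Multiset α) (F : α → ℂ) :
    avg A (fun a => conj (F a)) = conj (avg A F) := by
  simp [avg, map_multiset_sum, Multiset.map_map]

theorem avg_map (A : Multiset α) (f : α → β) (F : β → ℂ) :
    avg (A.map f) F = avg A fun a => F (f a) := by
  simp [avg, Multiset.map_map]

theorem avg_product (A : Multiset α) (B : Multiset β) (F : α × β → ℂ) :
    avg (A ×ˢ B) F = avg A fun a => avg B fun b => F (a, b) := by
  have : ((A ×ˢ B).map F).sum = (A.map fun a => (B.map fun b => F (a, b)).sum).sum := by
    induction A using Multiset.induction_on with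
    | empty => simp
    | cons a A ih => simp [Multiset.cons_product, ih, Multiset.map_map]
  simp only [avg, this, Multiset.card_product, Nat.cast_mul, div_eq_mul_inv,
    Multiset.sum_map_mul_right, mul_inv]
  ring

theorem avg_comm (A : Multiset α) (B : Multiset β) (F : α → β → ℂ) :
    (avg A fun a => avg B fun b => F a b) = avg B fun b => avg A fun a => F a b := by
  simp only [avg, div_eq_mul_inv, Multiset.sum_map_mul_right]
  rw [Multiset.sum_map_sum_map]
  ring

theorem avg_congr {A : Multiset α} {F F' : α → ℂ} (h : ∀ a ∈ A, F a = F' a) :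
    avg A F = avg A F' := by
  simp only [avg]
  rw [Multiset.map_congr rfl h]

theorem avg_re (A : Multiset α) (F : α → ℂ) : (avg A F).re = avgR A fun a => (F a).re := by
  have : ((A.map F).sum).re = (A.map fun a => (F a).re).sum := by
    have := map_multiset_sum Complex.reLm (A.map F)
    simpa [Multiset.map_map, Function.comp_def] using this
  simp only [avg, avgR, ← this]
  rw [← Complex.ofReal_natCast, Complex.div_ofReal_re]

theorem norm_avg_le (A : Multiset α) (F : α → ℂ) : ‖avg A F‖ ≤ avgR A fun a => ‖F a‖ := by
  simp only [avg, avgR, norm_div, Complex.norm_natCast]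
  gcongr
  simpa [Multiset.map_map, Function.comp_def] using norm_multiset_sum_le (A.map F)

theorem avgR_mono {A : Multiset α} {F F' : α → ℝ} (h : ∀ a ∈ A, F a ≤ F' a) :
    avgR A F ≤ avgR A F' := by
  simp only [avgR]
  gcongr
  exact Multiset.sum_map_le_sum_map _ _ h

theorem avgR_nonneg {A : Multiset α} {F : α → ℝ} (h : ∀ a, 0 ≤ F a) : 0 ≤ avgR A F := by
  refine div_nonneg (Multiset.sum_nonneg ?_) (by positivity)
  simp only [Multiset.mem_map]
  rintro _ ⟨a, -, rfl⟩
  exact h a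

theorem avgR_const {A : Multiset α} (hA : A ≠ 0) (z : ℝ) : avgR A (fun _ => z) = z := by
  have : (A.card : ℝ) ≠ 0 := by simpa using hA
  simp [avgR, this]

theorem avgR_const_le (A : Multiset α) {z : ℝ} (hz : 0 ≤ z) : avgR A (fun _ => z) ≤ z := by
  by_cases hA : A = 0
  · simpa [avgR, hA] using hz
  · exact (avgR_const hA z).le

theorem norm_avg_le_of_le {A : Multiset α} {F : α → ℂ} {z : ℝ} (hz : 0 ≤ z)
    (h : ∀ a ∈ A, ‖F a‖ ≤ z) : ‖avg A F‖ ≤ z :=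
  (norm_avg_le A F).trans ((avgR_mono h).trans (avgR_const_le A hz))

theorem exists_norm_avg_le {A : Multiset α} (hA : A ≠ 0) (F : α → ℂ) :
    ∃ a ∈ A, ‖avg A F‖ ≤ ‖F a‖ := by
  by_contra! h
  obtain ⟨a, ha, hm⟩ : ∃ a ∈ A, ∀ b ∈ A, ‖F b‖ ≤ ‖F a‖ := by
    classical
    obtain ⟨a, ha, h⟩ := Finset.exists_max_image A.toFinset (fun a => ‖F a‖)
      (by simpa [Finset.nonempty_iff_ne_empty] using hA)
    exact ⟨a, by simpa using ha, fun b hb => h b (by simpa using hb)⟩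
  exact absurd (norm_avg_le_of_le (norm_nonneg _) hm) (not_le.2 (h a ha))

theorem avgR_sq_le (A : Multiset α) (F : α → ℝ) : avgR A F ^ 2 ≤ avgR A fun a => F a ^ 2 := by
  by_cases hA : A = 0
  · simp [avgR, hA]
  have hc : (0 : ℝ) < A.card := by
    simpa [Nat.pos_iff_ne_zero] using hA
  have h : 0 ≤ avgR A fun a => (F a - avgR A F) ^ 2 := avgR_nonneg fun _ => sq_nonneg _
  have h2 : (avgR A fun a => (F a - avgR A F) ^ 2) = (avgR A fun a => F a ^ 2) - avgR A F ^ 2 := by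
    have : ∀ m : ℝ, (A.map fun a => (F a - m) ^ 2).sum
        = (A.map fun a => F a ^ 2).sum - 2 * m * (A.map F).sum + A.card * m ^ 2 := by
      intro m
      simp only [sub_sq, Multiset.sum_map_add, Multiset.sum_map_sub, Multiset.sum_map_mul_right,
        Multiset.sum_map_mul_left, Multiset.map_const', Multiset.sum_replicate, nsmul_eq_mul]
      ring
    simp only [avgR] at this ⊢
    rw [this]
    field_simp
    ring
  linarith

theorem avgR_pow_le (A : Multiset α) {F : α → ℝ} (hF : ∀ a, 0 ≤ F a) (n : ℕ) :
    avgR A F ^ 2 ^ n ≤ avgR A fun a => F a ^ 2 ^ n := by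
  induction n with
  | zero => simp
  | succ n ih =>
    simp only [pow_succ, pow_mul]
    exact (pow_le_pow_left₀ (pow_nonneg (avgR_nonneg hF) _) ih 2).trans (avgR_sq_le A _)

/-- The product of finitely many multisets, as a multiset of tuples. -/
def piM : {n : ℕ} → (Fin n → Multiset K) → Multiset (Fin n → K)
  | 0, _ => {Fin.elim0}
  | n + 1, A => (A (Fin.last n) ×ˢ piM fun i => A i.castSucc).map
      fun p => Fin.snoc (α := fun _ => K) p.2 p.1

theorem avg_piM_zero (A : Fin 0 → Multiset K) (F : (Fin 0 → K) → ℂ) :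
    avg (piM A) F = F Fin.elim0 := by
  simp [avg, piM]

theorem avg_piM_succ {n : ℕ} (A : Fin (n + 1) → Multiset K) (F : (Fin (n + 1) → K) → ℂ) :
    avg (piM A) F = avg (A (Fin.last n)) fun a => avg (piM fun i => A i.castSucc) fun p =>
      F (Fin.snoc (α := fun _ => K) p a) := by
  rw [piM, avg_map, avg_product]

theorem piM_ne_zero {n : ℕ} {A : Fin n → Multiset K} (hA : ∀ i, A i ≠ 0) : piM A ≠ 0 := by
  induction n with
  | zero => simp [piM]
  | succ n ih =>
    rw [piM, Ne, Multiset.map_eq_zero, ← Multiset.card_eq_zero, Multiset.card_product]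
    simpa using ⟨hA _, ih fun i => hA _⟩

theorem mem_of_mem_piM {n : ℕ} {A : Fin n → Multiset K} {p : Fin n → K} (hp : p ∈ piM A)
    (i : Fin n) : p i ∈ A i := by
  induction n with
  | zero => exact i.elim0
  | succ n ih =>
    rw [piM, Multiset.mem_map] at hp
    obtain ⟨⟨a, q⟩, hq, rfl⟩ := hp
    rw [Multiset.mem_product] at hq
    refine Fin.lastCases ?_ (fun j => ?_) i
    · simpa using hq.1
    · simpa using ih hq.2 j

theorem avg_piM_prod {n : ℕ} (A : Fin n → Multiset K) (F : Fin n → K → ℂ) :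
    avg (piM A) (fun p => ∏ i, F i (p i)) = ∏ i, avg (A i) (F i) := by
  induction n with
  | zero => simp [avg_piM_zero]
  | succ n ih =>
    rw [avg_piM_succ]
    simp only [Fin.prod_univ_castSucc, Fin.snoc_castSucc, Fin.snoc_last]
    simp only [avg_mul_right, avg_mul_left, ih]

end Averages


/-! ### Bounded functions and the Gowers–Cauchy–Schwarz inequality. -/

section Ball

variable {G X α : Type*} [AddCommGroup G] [AddAction G X] [MeasurableSpace X] {μ : Measure X}

/-- Measurable functions bounded by `1` everywhere. -/
def Ball (u : X → ℂ) : Prop := Measurable u ∧ ∀ x, ‖u x‖ ≤ 1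

theorem Ball.mul {u v : X → ℂ} (hu : Ball u) (hv : Ball v) : Ball fun x => u x * v x :=
  ⟨hu.1.mul hv.1, fun x => by
    rw [norm_mul]; exact mul_le_one₀ (hu.2 x) (norm_nonneg _) (hv.2 x)⟩

theorem Ball.conj {u : X → ℂ} (hu : Ball u) : Ball fun x => conj (u x) :=
  ⟨Complex.continuous_conj.measurable.comp hu.1, fun x => by simpa using hu.2 x⟩

theorem Ball.prod {ι : Type*} (s : Finset ι) {u : ι → X → ℂ} (hu : ∀ i, Ball (u i)) :
    Ball fun x => ∏ i ∈ s, u i x :=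
  ⟨Finset.measurable_fun_prod _ fun i _ => (hu i).1, fun x => by
    rw [norm_prod]; exact Finset.prod_le_one (fun _ _ => norm_nonneg _) fun i _ => (hu i).2 x⟩

theorem Ball.const {z : ℂ} (hz : ‖z‖ ≤ 1) : Ball fun _ : X => z := ⟨measurable_const, fun _ => hz⟩

theorem measurable_avg (A : Multiset α) {F : α → X → ℂ} (hF : ∀ a, Measurable (F a)) :
    Measurable fun x => avg A fun a => F a x := by
  simp only [avg]
  refine Measurable.div_const ?_ _
  induction A using Multiset.induction_on with
  | empty => simp
  | cons a A ih => simpa [Pi.add_def] using (hF a).add ih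

theorem Ball.avg (A : Multiset α) {F : α → X → ℂ} (hF : ∀ a, Ball (F a)) :
    Ball fun x => avg A fun a => F a x :=
  ⟨measurable_avg A fun a => (hF a).1, fun x =>
    norm_avg_le_of_le zero_le_one fun a _ => (hF a).2 x⟩

theorem Ball.integrable [IsFiniteMeasure μ] {u : X → ℂ} (hu : Ball u) :
    Integrable u μ :=
  Integrable.of_bound hu.1.aestronglyMeasurable 1 (ae_of_all _ hu.2)

theorem Ball.norm_integral_le [IsProbabilityMeasure μ] {u : X → ℂ} (hu : Ball u) :
    ‖∫ x, u x ∂μ‖ ≤ 1 := by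
  simpa using norm_integral_le_of_norm_le_const (μ := μ) (C := 1) (ae_of_all _ hu.2)

theorem integral_avg (A : Multiset α) {F : α → X → ℂ}
    (hF : ∀ a, Integrable (F a) μ) :
    ∫ x, avg A (fun a => F a x) ∂μ = avg A fun a => ∫ x, F a x ∂μ := by
  simp only [BoxConcat.avg, integral_div]
  congr 1
  have : Integrable (fun x => (A.map fun a => F a x).sum) μ ∧
      ∫ x, (A.map fun a => F a x).sum ∂μ = (A.map fun a => ∫ x, F a x ∂μ).sum := by
    induction A using Multiset.induction_on with
    | empty => simp
    | cons a A ih =>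
      simp only [Multiset.map_cons, Multiset.sum_cons]
      exact ⟨(hF a).add ih.1, by rw [integral_add (hF a) ih.1, ih.2]⟩
  exact this.2

theorem sq_norm_integral_mul_le [IsProbabilityMeasure μ] {b y : X → ℂ}
    (hb : Ball b) (hy : Ball y) :
    ‖∫ x, b x * y x ∂μ‖ ^ 2 ≤ (∫ x, y x * conj (y x) ∂μ).re := by
  set m : ℝ := ∫ x, ‖y x‖ ∂μ with hm
  have hy1 : Integrable (fun x => ‖y x‖) μ := hy.integrable.norm
  have hy2 : Integrable (fun x => ‖y x‖ ^ 2) μ := by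
    refine Integrable.of_bound (hy.1.norm.pow_const 2).aestronglyMeasurable 1 (ae_of_all _ fun x => ?_)
    simpa using pow_le_one₀ (n := 2) (norm_nonneg _) (hy.2 x)
  have h1 : ‖∫ x, b x * y x ∂μ‖ ≤ m := by
    refine (norm_integral_le_integral_norm _).trans (integral_mono (hb.mul hy).integrable.norm hy1 ?_)
    intro x
    simp only [norm_mul]
    exact mul_le_of_le_one_left (norm_nonneg _) (hb.2 x)
  have h2 : (∫ x, y x * conj (y x) ∂μ).re = ∫ x, ‖y x‖ ^ 2 ∂μ := by
    simp only [Complex.mul_conj, Complex.normSq_eq_norm_sq]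
    rw [integral_complex_ofReal, Complex.ofReal_re]
  have h3 : 0 ≤ ∫ x, (‖y x‖ - m) ^ 2 ∂μ := integral_nonneg fun _ => sq_nonneg _
  have h4 : ∫ x, (‖y x‖ - m) ^ 2 ∂μ = ∫ x, ‖y x‖ ^ 2 ∂μ - m ^ 2 := by
    have : ∀ x, (‖y x‖ - m) ^ 2 = ‖y x‖ ^ 2 - 2 * m * ‖y x‖ + m ^ 2 := fun x => by ring
    simp only [this]
    have hs : Integrable (fun x => ‖y x‖ ^ 2 - 2 * m * ‖y x‖) μ := hy2.sub (hy1.const_mul _)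
    rw [integral_add hs (integrable_const _),
      integral_sub hy2 (hy1.const_mul _), integral_const_mul, ← hm]
    simp
    ring
  rw [h2]
  have := pow_le_pow_left₀ (norm_nonneg _) h1 2
  linarith

theorem boxPow_conj {d : ℕ} (Q : Fin d → Multiset G) (f : X → ℂ) :
    boxPow μ d Q (fun x => conj (f x)) = conj (boxPow μ d Q f) := by
  induction d generalizing f with
  | zero => simp only [boxPow]; exact integral_conj
  | succ d ih =>
    simp only [boxPow, ← avg_conj, ← ih]
    congr! 7
    simp [BoxConcat.delta, shift]

theorem boxNorm_conj {d : ℕ} (Q : Fin d → Multiset G) (f : X → ℂ) :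
    boxNorm μ Q (fun x => conj (f x)) = boxNorm μ Q f := by
  simp [boxNorm, boxPow_conj]

theorem le_boxNorm_iff {d : ℕ} {Q : Fin d → Multiset G} {f : X → ℂ} {t : ℝ} (ht : 0 ≤ t) :
    t ≤ boxNorm μ Q f ↔ t ^ 2 ^ d ≤ ‖boxPow μ d Q f‖ := by
  rw [boxNorm, one_div, Real.le_rpow_inv_iff_of_pos ht (norm_nonneg _) (by positivity)]
  norm_cast

variable [MeasurableConstVAdd G X]

theorem Ball.vadd {u : X → ℂ} (hu : Ball u) (g : G) : Ball fun x => u (g +ᵥ x) :=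
  ⟨hu.1.comp (measurable_const_vadd g), fun _ => hu.2 _⟩

theorem Ball.delta {u : X → ℂ} (hu : Ball u) (h h' : G) : Ball (delta h h' u) :=
  (hu.vadd (-h)).mul (hu.vadd (-h')).conj

theorem integral_vadd [VAddInvariantMeasure G X μ] (g : G) (u : X → ℂ) :
    ∫ x, u (g +ᵥ x) ∂μ = ∫ x, u x ∂μ :=
  integral_vadd_eq_self u (g := g)

theorem boxPow_congr_ae [VAddInvariantMeasure G X μ] {d : ℕ} (Q : Fin d → Multiset G)
    {f f' : X → ℂ} (h : f =ᵐ[μ] f') : boxPow μ d Q f = boxPow μ d Q f' := by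
  induction d generalizing f f' with
  | zero => exact integral_congr_ae h
  | succ d ih =>
    simp only [boxPow]
    refine avg_congr fun a _ => avg_congr fun b _ => ih _ ?_
    have key : ∀ g : G, (fun x => f (g +ᵥ x)) =ᵐ[μ] fun x => f' (g +ᵥ x) := fun g =>
      (measurePreserving_vadd g μ).quasiMeasurePreserving.ae_eq_comp h
    filter_upwards [key (-a), key (-b)] with x h1 h2
    simp only [BoxConcat.delta, shift, h1, h2]

/-- The Cauchy–Schwarz step in the last variable. -/
theorem box_cauchy_schwarz_step {K : Type*} [Zero K] [IsProbabilityMeasure μ] {D : ℕ}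
    (P : Fin (D + 1) → Multiset K) (σ : K → G) {g : X → ℂ} (hg : Ball g)
    {B : Fin (D + 1) → (Fin (D + 1) → K) → X → ℂ} (hB : ∀ c p, Ball (B c p))
    (hind : ∀ c p p', (∀ c', c' ≠ c → p c' = p' c') → B c p = B c p') :
    ‖avg (piM P) fun p => ∫ x, g (-(∑ c, σ (p c)) +ᵥ x) * ∏ c, B c p x ∂μ‖ ^ 2 ≤
      (avg (P (Fin.last D)) fun a => avg (P (Fin.last D)) fun a' =>
        avg (piM fun c => P c.castSucc) fun p =>
          ∫ x, delta (σ a) (σ a') g (-(∑ c, σ (p c)) +ᵥ x) *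
            ∏ c : Fin D, (B c.castSucc (Fin.snoc (α := fun _ => K) p a) x *
              conj (B c.castSucc (Fin.snoc (α := fun _ => K) p a') x)) ∂μ).re := by
  set Y : (Fin D → K) → K → X → ℂ := fun p a x =>
    g (-(∑ c, σ (p c) + σ a) +ᵥ x) * ∏ c : Fin D, B c.castSucc (Fin.snoc (α := fun _ => K) p a) x
    with hYdef
  have hY : ∀ p a, Ball (Y p a) := fun p a =>
    (hg.vadd _).mul (Ball.prod _ fun c => hB _ _)
  -- The last factor ignores the last coordinate, so this coordinate can be frozen at the arbitrary
  -- value `0` and the factor leaves the average over it.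
  have hb : ∀ p a, B (Fin.last D) (Fin.snoc (α := fun _ => K) p a)
      = B (Fin.last D) (Fin.snoc (α := fun _ => K) p 0) := by
    intro p a
    refine hind _ _ _ fun c' hc' => ?_
    obtain ⟨j, rfl⟩ : ∃ j : Fin D, c' = j.castSucc :=
      ⟨c'.castPred hc', by simp⟩
    simp
  have e1 : (avg (piM P) fun p => ∫ x, g (-(∑ c, σ (p c)) +ᵥ x) * ∏ c, B c p x ∂μ)
      = avg (piM fun c => P c.castSucc) fun p =>
        ∫ x, B (Fin.last D) (Fin.snoc (α := fun _ => K) p 0) x *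
          avg (P (Fin.last D)) (fun a => Y p a x) ∂μ := by
    rw [avg_piM_succ, avg_comm]
    refine avg_congr fun p _ => ?_
    simp only [← avg_mul_left]
    rw [integral_avg _ fun a => ((hB _ _).mul (hY p a)).integrable]
    refine avg_congr fun a _ => ?_
    congr 1
    ext x
    simp only [Fin.sum_univ_castSucc, Fin.prod_univ_castSucc, Fin.snoc_castSucc, Fin.snoc_last,
      hb p a, hYdef]
    ring
  -- Expanding the square doubles the last variable and turns `g` into `delta (σ a) (σ a') g`.
  have e2 : ∀ p, (∫ x, avg (P (Fin.last D)) (fun a => Y p a x) *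
        conj (avg (P (Fin.last D)) (fun a => Y p a x)) ∂μ)
      = avg (P (Fin.last D)) fun a => avg (P (Fin.last D)) fun a' =>
          ∫ x, delta (σ a) (σ a') g (-(∑ c, σ (p c)) +ᵥ x) *
            ∏ c : Fin D, (B c.castSucc (Fin.snoc (α := fun _ => K) p a) x *
              conj (B c.castSucc (Fin.snoc (α := fun _ => K) p a') x)) ∂μ := by
    intro p
    simp only [← avg_conj, ← avg_mul_right]
    rw [integral_avg _ fun a => ((hY p a).mul (Ball.avg _ fun a' => (hY p a').conj)).integrable]
    refine avg_congr fun a _ => ?_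
    simp only [← avg_mul_left]
    rw [integral_avg _ fun a' => ((hY p a).mul (hY p a').conj).integrable]
    refine avg_congr fun a' _ => ?_
    congr 1
    ext x
    simp only [hYdef, BoxConcat.delta, shift, map_mul, map_prod, Finset.prod_mul_distrib, vadd_vadd,
      neg_add, add_comm]
    ring
  rw [e1]
  calc _ ≤ (avgR (piM fun c => P c.castSucc) fun p =>
        ‖∫ x, B (Fin.last D) (Fin.snoc (α := fun _ => K) p 0) x *
          avg (P (Fin.last D)) (fun a => Y p a x) ∂μ‖) ^ 2 :=
        pow_le_pow_left₀ (norm_nonneg _) (norm_avg_le _ _) 2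
    _ ≤ _ := avgR_sq_le _ _
    _ ≤ avgR (piM fun c => P c.castSucc) fun p =>
        (∫ x, avg (P (Fin.last D)) (fun a => Y p a x) *
          conj (avg (P (Fin.last D)) (fun a => Y p a x)) ∂μ).re :=
        avgR_mono fun p _ => sq_norm_integral_mul_le (hB _ _) (Ball.avg _ fun a => hY p a)
    _ = _ := by
        rw [← avg_re]
        congr 1
        simp only [e2]
        rw [avg_comm]
        refine avg_congr fun a _ => ?_
        rw [avg_comm]

/-- The Gowers–Cauchy–Schwarz inequality for box norms. -/
theorem box_cauchy_schwarz {K : Type*} [Zero K] [IsProbabilityMeasure μ] {D : ℕ} (hD : 0 < D)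
    (P : Fin D → Multiset K) (σ : K → G) {g : X → ℂ} (hg : Ball g)
    {B : Fin D → (Fin D → K) → X → ℂ} (hB : ∀ c p, Ball (B c p))
    (hind : ∀ c p p', (∀ c', c' ≠ c → p c' = p' c') → B c p = B c p') :
    ‖avg (piM P) fun p => ∫ x, g (-(∑ c, σ (p c)) +ᵥ x) * ∏ c, B c p x ∂μ‖ ^ 2 ^ D ≤
      (boxPow μ D (fun c => (P c).map σ) g).re := by
  induction D, Nat.succ_le_of_lt hD using Nat.le_induction generalizing g with
  | base =>
    have := box_cauchy_schwarz_step (μ := μ) P σ hg hB hind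
    simpa [boxPow, avg_map, avg_piM_zero] using this
  | succ D hD' ih =>
    have hD0 : 0 < D := hD'
    rw [pow_succ' 2 D, pow_mul]
    have h1 := box_cauchy_schwarz_step (μ := μ) P σ hg hB hind
    -- Jensen moves the remaining power inside the averages over `a` and `a'`; the induction
    -- hypothesis is then applied to each `delta (σ a) (σ a') g`.
    refine (pow_le_pow_left₀ (sq_nonneg _) (h1.trans (Complex.re_le_norm _)) _).trans ?_
    refine (pow_le_pow_left₀ (norm_nonneg _) (norm_avg_le _ _) _).trans ?_
    refine (avgR_pow_le _ (fun _ => norm_nonneg _) _).trans ?_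
    simp only [boxPow, avg_map, avg_re]
    refine avgR_mono fun a _ => ?_
    refine (pow_le_pow_left₀ (norm_nonneg _) (norm_avg_le _ _) _).trans ?_
    refine (avgR_pow_le _ (fun _ => norm_nonneg _) _).trans ?_
    refine avgR_mono fun a' _ => ?_
    refine ih hD0 (fun c => P c.castSucc) (hg.delta (σ a) (σ a'))
      (B := fun c p x => B c.castSucc (Fin.snoc (α := fun _ => K) p a) x *
        conj (B c.castSucc (Fin.snoc (α := fun _ => K) p a') x))
      (fun c p => (hB _ _).mul (hB _ _).conj) ?_
    intro c p p' h
    have key : ∀ b : K, B c.castSucc (Fin.snoc (α := fun _ => K) p b)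
        = B c.castSucc (Fin.snoc (α := fun _ => K) p' b) := by
      intro b
      refine hind _ _ _ fun c' hc' => ?_
      induction c' using Fin.lastCases with
      | last => simp
      | cast j =>
        simp only [Fin.snoc_castSucc]
        exact h j fun hj => hc' (by rw [hj])
    simp only [key]

end Ball


/-! ### Cube expansion of the box norm and dual functions. -/

section Cube

/-- The number of ones of a vertex of the discrete cube. -/
def weight {d : ℕ} (ω : Fin d → Bool) : ℕ := ∑ i, if ω i then 1 else 0

/-- The `n`-fold complex conjugation. -/
noncomputable def conjPow (n : ℕ) (z : ℂ) : ℂ := (starRingEnd ℂ)^[n] z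

theorem conjPow_mul (n : ℕ) (z w : ℂ) : conjPow n (z * w) = conjPow n z * conjPow n w :=
  iterate_map_mul (starRingEnd ℂ) n z w

theorem conjPow_succ (n : ℕ) (z : ℂ) : conjPow (n + 1) z = conjPow n (conj z) := rfl

/-- The number of nonzero vertices of the discrete cube. -/
def numSlots (d : ℕ) : ℕ := Fintype.card {ω : Fin d → Bool // ω ≠ fun _ => false}

/-- An enumeration of the nonzero vertices of the discrete cube. -/
noncomputable def slot {d : ℕ} (s : Fin (numSlots d)) : Fin d → Bool :=
  ((Fintype.equivFin {ω : Fin d → Bool // ω ≠ fun _ => false}).symm s).1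

theorem exists_slot_eq_true {d : ℕ} (s : Fin (numSlots d)) : ∃ i, slot s i = true := by
  have := ((Fintype.equivFin {ω : Fin d → Bool // ω ≠ fun _ => false}).symm s).2
  by_contra h
  exact this (funext fun i => Bool.eq_false_iff.2 fun hi => h ⟨i, hi⟩)

/-- A coordinate at which the vertex `slot s` does not vanish. -/
noncomputable def slotIndex {d : ℕ} (s : Fin (numSlots d)) : Fin d := (exists_slot_eq_true s).choose

theorem slot_slotIndex {d : ℕ} (s : Fin (numSlots d)) : slot s (slotIndex s) = true :=
  (exists_slot_eq_true s).choose_spec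

/-- The zero vertex is set apart because it will carry the tested function, while the other vertices
make up its dual function. -/
theorem prod_cube_eq {d : ℕ} (F : (Fin d → Bool) → ℂ) :
    ∏ ω, F ω = F (fun _ => false) * ∏ s : Fin (numSlots d), F (slot s) := by
  classical
  rw [← Finset.mul_prod_erase Finset.univ F (Finset.mem_univ fun _ => false)]
  congr 1
  have h1 := Fintype.prod_equiv (Fintype.equivFin {ω : Fin d → Bool // ω ≠ fun _ => false}).symm
    (fun s : Fin (numSlots d) => F (slot s)) (fun ω => F ω.1) fun s => rfl
  refine Eq.trans (Finset.prod_subtype _ (fun ω => ?_) F) h1.symm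
  simp

/-- The sum of the coordinates of `k` selected by the vertex `ω`. -/
def dot {G : Type*} [AddCommMonoid G] {d : ℕ} (ω : Fin d → Bool) (k : Fin d → G) : G :=
  ∑ i, if ω i then k i else 0

theorem dot_add {G : Type*} [AddCommMonoid G] {d : ℕ} (ω : Fin d → Bool) (k k' : Fin d → G) :
    dot ω (k + k') = dot ω k + dot ω k' := by
  simp only [dot, ← Finset.sum_add_distrib]
  exact Finset.sum_congr rfl fun i _ => by by_cases h : ω i <;> simp [h]

theorem dot_single {G : Type*} [AddCommMonoid G] {d : ℕ} {ω : Fin d → Bool} {i : Fin d}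
    (h : ω i = true) (t : G) : dot ω (Pi.single i t) = t := by
  rw [dot, Finset.sum_eq_single i]
  · simp [h]
  · intro j _ hj
    simp [hj]
  · simp

variable {G X : Type*} [AddCommGroup G] [AddAction G X] [MeasurableSpace X] {μ : Measure X}

theorem Ball.conjPow {u : X → ℂ} (hu : Ball u) (n : ℕ) : Ball fun x => conjPow n (u x) := by
  induction n generalizing u with
  | zero => exact hu
  | succ n ih => exact ih hu.conj

/-- Each `delta` splits the cube into two opposite faces, the second one conjugated once more; hence
the exponent `weight ω`. -/
theorem boxPow_eq_cube (d : ℕ) (P : Fin d → Multiset G) (w : X → ℂ) :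
    boxPow μ d P w = avg (piM P) fun h => avg (piM P) fun l =>
      ∫ x, ∏ ω : Fin d → Bool,
        conjPow (weight ω) (w (-(∑ i, if ω i then l i else h i) +ᵥ x)) ∂μ := by
  induction d generalizing w with
  | zero => simp [boxPow, avg_piM_zero, weight, BoxConcat.conjPow]
  | succ d ih =>
    simp only [boxPow, avg_piM_succ, ih]
    refine avg_congr fun a _ => ?_
    rw [avg_comm]
    refine avg_congr fun h _ => avg_congr fun a' _ => avg_congr fun l _ => ?_
    congr 1
    ext x
    rw [← Fintype.prod_equiv (Fin.snocEquiv fun _ => Bool) _ _ fun _ => rfl,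
      Fintype.prod_prod_type, Fintype.prod_bool, ← Finset.prod_mul_distrib]
    refine Finset.prod_congr rfl fun ω _ => ?_
    simp only [Fin.snocEquiv, Equiv.coe_fn_mk, weight, Fin.sum_univ_castSucc, Fin.snoc_castSucc,
      Fin.snoc_last, delta, shift, conjPow_mul, if_true, conjPow_succ, vadd_vadd, neg_add, add_comm (-a),
      add_comm (-a'), Bool.false_eq_true, if_false, add_zero]
    ring

variable [MeasurableConstVAdd G X] [VAddInvariantMeasure G X μ]

/-- Translating `x` by `∑ i, h i` brings the zero vertex to `w x` and makes the other vertices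
depend on `l - h` alone. -/
theorem boxPow_eq_slots (d : ℕ) (P : Fin d → Multiset G) (w : X → ℂ) :
    boxPow μ d P w = avg (piM P) fun h => avg (piM P) fun l =>
      ∫ x, w x * ∏ s : Fin (numSlots d),
        conjPow (weight (slot s)) (w (-(dot (slot s) (l - h)) +ᵥ x)) ∂μ := by
  rw [boxPow_eq_cube]
  refine avg_congr fun h _ => avg_congr fun l _ => ?_
  rw [← integral_vadd (∑ i, h i)]
  congr 1
  ext x
  have key : ∀ ω : Fin d → Bool, -(∑ i, if ω i then l i else h i) + ∑ i, h i
      = -(dot ω (l - h)) := by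
    intro ω
    rw [dot, ← Finset.sum_neg_distrib, ← Finset.sum_add_distrib, ← Finset.sum_neg_distrib]
    exact Finset.sum_congr rfl fun i _ => by by_cases hi : ω i <;> simp [hi, neg_add_eq_sub]
  simp only [vadd_vadd, key]
  rw [prod_cube_eq]
  simp [weight, dot, conjPow]

/-- `φ` is a dual function along `P`: an average over `l ∈ P₁ × ⋯ × P_d` of products of bounded
functions `B_j(l, ·)`, where `B_j(l, x)` is unchanged when `x` and `l_j` are translated by the same
group element. -/
def IsDual {d : ℕ} (P : Fin d → Multiset G) (φ : X → ℂ) : Prop :=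
  ∃ B : Fin d → (Fin d → G) → X → ℂ, (∀ j l, Ball (B j l)) ∧
    (∀ j l t x, B j (l + Pi.single j t) (t +ᵥ x) = B j l x) ∧
    φ = fun x => avg (piM P) fun l => ∏ j, B j l x

omit [MeasurableConstVAdd G X] in
theorem IsDual.ball {d : ℕ} {P : Fin d → Multiset G} {φ : X → ℂ} (h : IsDual P φ) : Ball φ := by
  obtain ⟨B, hB, -, rfl⟩ := h
  exact Ball.avg _ fun l => Ball.prod _ fun j => hB j l

/-- Some `h` does at least as well as the average, and it is frozen. Each nonzero vertex is then
charged to a coordinate where it equals one (`slotIndex`): its factor is unchanged when `x` and that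
coordinate of `l` move together. -/
theorem exists_isDual [IsProbabilityMeasure μ] {d : ℕ} {P : Fin d → Multiset G}
    (hP : ∀ i, P i ≠ 0) {w : X → ℂ} (hw : Ball w) :
    ∃ φ, IsDual P φ ∧ ‖boxPow μ d P w‖ ≤ ‖∫ x, φ x * w x ∂μ‖ := by
  rw [boxPow_eq_slots]
  obtain ⟨h, -, hh⟩ := exists_norm_avg_le (piM_ne_zero hP) fun h => avg (piM P) fun l =>
      ∫ x, w x * ∏ s : Fin (numSlots d),
        conjPow (weight (slot s)) (w (-(dot (slot s) (l - h)) +ᵥ x)) ∂μ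
  set C : Fin (numSlots d) → (Fin d → G) → X → ℂ := fun s l x =>
    conjPow (weight (slot s)) (w (-(dot (slot s) (l - h)) +ᵥ x)) with hC
  have hCB : ∀ s l, Ball (C s l) := fun s l => (hw.vadd _).conjPow _
  refine ⟨_, ⟨fun j l x => ∏ s with slotIndex s = j, C s l x, fun j l => Ball.prod _ fun s => hCB s l,
    ?_, rfl⟩, hh.trans_eq ?_⟩
  · intro j l t x
    refine Finset.prod_congr rfl fun s hs => ?_
    have hs' : slot s j = true := by
      rw [← (Finset.mem_filter.1 hs).2]; exact slot_slotIndex s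
    simp only [hC]
    rw [add_sub_right_comm, dot_add, dot_single hs', vadd_vadd]
    congr 3
    abel
  · congr 1
    simp only [← avg_mul_right]
    rw [integral_avg]
    · refine avg_congr fun l _ => ?_
      congr 1
      ext x
      rw [mul_comm, ← Finset.prod_fiberwise Finset.univ slotIndex]
    · exact fun l => ((Ball.prod _ fun j => Ball.prod _ fun s => hCB s l).mul hw).integrable

end Cube


/-! ### Almost invariance of averages over progressions. -/

section AlmostInvariance

variable {α β K : Type*} [AddCommGroup α] [AddCommGroup β] [AddCommGroup K]

/-- Averages of `1`-bounded functions over `A` change by at most `κ` under translation by `q`. -/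
def AlmostInv (A : Multiset α) (q : α) (κ : ℝ) : Prop :=
  ∀ F : α → ℂ, (∀ a, ‖F a‖ ≤ 1) → ‖avg A F - avg A fun a => F (a - q)‖ ≤ κ

theorem AlmostInv.mono {A : Multiset α} {q : α} {κ κ' : ℝ} (h : AlmostInv A q κ) (hκ : κ ≤ κ') :
    AlmostInv A q κ' := fun F hF => (h F hF).trans hκ

theorem AlmostInv.zero (A : Multiset α) : AlmostInv A 0 0 := fun F _ => by simp

theorem AlmostInv.add {A : Multiset α} {q q' : α} {κ κ' : ℝ} (h : AlmostInv A q κ)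
    (h' : AlmostInv A q' κ') : AlmostInv A (q + q') (κ + κ') := fun F hF => by
  have h1 := h F hF
  have h2 := h' (fun a => F (a - q)) fun a => hF _
  refine (norm_sub_le_norm_sub_add_norm_sub _ (avg A fun a => F (a - q)) _).trans ?_
  simp only [sub_sub, add_comm q' q] at h2
  exact add_le_add h1 h2

theorem AlmostInv.neg {A : Multiset α} {q : α} {κ : ℝ} (h : AlmostInv A q κ) :
    AlmostInv A (-q) κ := fun F hF => by
  have := h (fun a => F (a + q)) fun a => hF _
  rw [norm_sub_rev]
  simpa using this

theorem AlmostInv.nsmul {A : Multiset α} {q : α} {κ : ℝ} (h : AlmostInv A q κ) (n : ℕ) :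
    AlmostInv A (n • q) (n * κ) := by
  induction n with
  | zero => simpa using AlmostInv.zero A
  | succ n ih =>
    rw [succ_nsmul]
    exact (ih.add h).mono (by push_cast; linarith)

theorem AlmostInv.zsmul {A : Multiset α} {q : α} {κ : ℝ} (h : AlmostInv A q κ) (n : ℤ) :
    AlmostInv A (n • q) (|(n : ℝ)| * κ) := by
  obtain ⟨m, rfl | rfl⟩ := n.eq_nat_or_neg
  · simpa using h.nsmul m
  · simpa using (h.nsmul m).neg

theorem AlmostInv.sum {ι : Type*} {A : Multiset α} {q : ι → α} {κ : ℝ}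
    (h : ∀ i, AlmostInv A (q i) κ) (s : Finset ι) : AlmostInv A (∑ i ∈ s, q i) (s.card * κ) := by
  classical
  induction s using Finset.induction_on with
  | empty => simpa using AlmostInv.zero A
  | insert i s hi ih =>
    rw [Finset.sum_insert hi, Finset.card_insert_of_notMem hi]
    exact ((h i).add ih).mono (by push_cast; linarith)

theorem AlmostInv.product {A : Multiset α} {B : Multiset β} {p : α} {q : β} {κ κ' : ℝ}
    (hA : AlmostInv A p κ) (hB : AlmostInv B q κ') (hκ : 0 ≤ κ) (hκ' : 0 ≤ κ') :
    AlmostInv (A ×ˢ B) (p, q) (κ + κ') := fun F hF => by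
  simp only [avg_product, Prod.mk_sub_mk]
  refine (norm_sub_le_norm_sub_add_norm_sub _
    (avg A fun a => avg B fun b => F (a - p, b)) _).trans (add_le_add ?_ ?_)
  · rw [avg_comm A B fun a b => F (a, b), avg_comm A B fun a b => F (a - p, b), ← avg_sub]
    exact norm_avg_le_of_le hκ fun b _ => hA (fun a => F (a, b)) fun a => hF _
  · rw [← avg_sub]
    exact norm_avg_le_of_le hκ' fun a _ => hB (fun b => F (a - p, b)) fun b => hF _

theorem AlmostInv.map {A : Multiset α} {q : α} {κ : ℝ} (h : AlmostInv A q κ) {φ : α → β}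
    (hφ : ∀ a b, φ (a - b) = φ a - φ b) : AlmostInv (A.map φ) (φ q) κ := fun F hF => by
  simp only [avg_map, ← hφ]
  exact h (fun a => F (φ a)) fun a => hF _

theorem AlmostInv.pi {n : ℕ} {A : Fin n → Multiset K} {q : Fin n → K} {κ : ℝ} (hκ : 0 ≤ κ)
    (h : ∀ i, AlmostInv (A i) (q i) κ) : AlmostInv (piM A) q (n * κ) := by
  induction n with
  | zero =>
    obtain rfl : q = 0 := Subsingleton.elim _ _
    exact (AlmostInv.zero _).mono (by simp)
  | succ n ih =>
    have h1 := ((h (Fin.last n)).product (ih fun i => h i.castSucc) hκ (by positivity)).map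
      (φ := fun p => Fin.snoc (α := fun _ => K) p.2 p.1) (by
        rintro ⟨a, p⟩ ⟨b, q⟩
        funext i
        refine Fin.lastCases ?_ (fun j => ?_) i
        · simp only [Prod.mk_sub_mk, Fin.snoc_last, Pi.sub_apply]
        · simp only [Prod.mk_sub_mk, Fin.snoc_castSucc, Pi.sub_apply])
    have h2 : Fin.snoc (α := fun _ => K) (fun i : Fin n => q i.castSucc) (q (Fin.last n)) = q := by
      funext i
      refine Fin.lastCases ?_ (fun j => ?_) i
      · simp only [Fin.snoc_last]
      · simp only [Fin.snoc_castSucc]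
    rw [h2] at h1
    exact h1.mono (by push_cast; linarith)

omit [AddCommGroup K] in
theorem mem_piM {n : ℕ} {A : Fin n → Multiset K} {p : Fin n → K} :
    p ∈ piM A ↔ ∀ i, p i ∈ A i := by
  refine ⟨fun h i => mem_of_mem_piM h i, fun h => ?_⟩
  induction n with
  | zero => simp [piM, Subsingleton.elim p Fin.elim0]
  | succ n ih =>
    rw [piM, Multiset.mem_map]
    refine ⟨(p (Fin.last n), fun i => p i.castSucc),
      Multiset.mem_product.2 ⟨h _, ih fun i => h _⟩, ?_⟩
    ext i
    refine Fin.lastCases ?_ (fun j => ?_) i <;> simp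

omit [AddCommGroup K] in
theorem nodup_piM {n : ℕ} {A : Fin n → Multiset K} (h : ∀ i, (A i).Nodup) :
    (piM A).Nodup := by
  induction n with
  | zero => simp [piM]
  | succ n ih =>
    refine Multiset.Nodup.map ?_ ((h _).product (ih fun i => h _))
    rintro ⟨a, p⟩ ⟨b, q⟩ hpq
    have h1 := congrFun hpq (Fin.last n)
    have h2 : p = q := funext fun i => by simpa using congrFun hpq i.castSucc
    simpa [h2] using h1

omit [AddCommGroup K] in
theorem piFinset_val {n : ℕ} [DecidableEq K] (A : Fin n → Finset K) :
    (Fintype.piFinset A).val = piM fun i => (A i).val := by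
  refine (Multiset.Nodup.ext (Finset.nodup _) (nodup_piM fun i => (A i).nodup)).2 fun p => ?_
  rw [mem_piM, Finset.mem_val, Fintype.mem_piFinset]
  rfl

/-- The difference telescopes to two boundary terms, against `2 * n + 1` points. -/
theorem almostInv_Icc_one (n : ℕ) :
    AlmostInv (Finset.Icc (-n : ℤ) n).val 1 (2 / (2 * n + 1)) := fun F hF => by
  have hc : (Finset.Icc (-n : ℤ) n).val.card = 2 * n + 1 := by
    rw [Finset.card_val, Int.card_Icc]; omega
  have key : ∑ a ∈ Finset.Icc (-n : ℤ) n, (F a - F (a - 1)) = F n - F (-n - 1) := by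
    clear hc
    induction n with
    | zero => simp
    | succ n ih =>
      have : Finset.Icc (-(n + 1 : ℕ) : ℤ) (n + 1 : ℕ)
          = insert ((n : ℤ) + 1) (insert (-(n : ℤ) - 1) (Finset.Icc (-n : ℤ) n)) := by
        ext a; simp only [Finset.mem_Icc, Finset.mem_insert]; push_cast; omega
      rw [this, Finset.sum_insert, Finset.sum_insert, ih]
      · push_cast
        ring_nf
      · simp
      · simp only [Finset.mem_insert, Finset.mem_Icc]; omega
  rw [← avg_sub]
  simp only [avg, hc]
  change ‖(∑ a ∈ Finset.Icc (-n : ℤ) n, (F a - F (a - 1))) / _‖ ≤ _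
  rw [key, norm_div, Complex.norm_natCast]
  push_cast
  gcongr
  exact (norm_sub_le _ _).trans (by linarith [hF n, hF (-n - 1)])

theorem almostInv_intBox {r : ℕ} {N : Fin r → ℝ} (hN : ∀ i, 0 < N i) {ε η : ℝ} (hε : 0 < ε)
    (hη : 0 < η) {m : Fin r → ℤ} (hm : m ∈ intBox fun i => η * N i) :
    AlmostInv (intBox fun i => ε * N i).val m (r * (2 * η / ε)) := by
  rw [intBox, piFinset_val]
  refine AlmostInv.pi (by positivity) fun i => ?_
  have hm' := Finset.mem_Icc.1 (Fintype.mem_piFinset.1 hm i)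
  have hεN := mul_pos hε (hN i)
  obtain ⟨n, hn⟩ := Int.eq_ofNat_of_zero_le (Int.floor_nonneg.2 hεN.le)
  rw [hn]
  have h1 := (almostInv_Icc_one n).zsmul (m i)
  rw [zsmul_one] at h1
  refine AlmostInv.mono (by simpa using h1) ?_
  have h2 : |(m i : ℝ)| ≤ η * N i := by
    have h3 : |m i| ≤ ⌊η * N i⌋ := abs_le.2 hm'
    refine le_trans ?_ (Int.floor_le (η * N i))
    exact_mod_cast h3
  -- This also holds when `ε * N i < 1` and the box is a single point in this direction, so no lower
  -- bound on the dimensions is needed.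
  have h4 : ε * N i ≤ 2 * n + 1 := by
    have h5 := (Int.lt_floor_add_one (ε * N i)).le
    rw [hn] at h5
    have : (0 : ℝ) ≤ n := n.cast_nonneg
    push_cast at h5
    linarith
  have h6 : 0 ≤ η * N i := (mul_pos hη (hN i)).le
  calc |(m i : ℝ)| * (2 / (2 * n + 1)) ≤ η * N i * (2 / (ε * N i)) := by gcongr
    _ = 2 * η / ε := by have := (hN i).ne'; field_simp

end AlmostInvariance

namespace CosetProgression

variable {G : Type*} [AddCommGroup G] (Q : CosetProgression G)

theorem mem_torsion {h : G} : h ∈ Q.torsion ↔ h ∈ Q.H := by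
  have := Q.finite_H
  rw [torsion, Multiset.mem_nsmul_of_ne_zero Q.mult_pos.ne', Finset.mem_val,
    Set.Finite.mem_toFinset]
  rfl

theorem almostInv_torsion {h : G} (hh : h ∈ Q.H) : AlmostInv Q.torsion h 0 := fun F _ => by
  have := Q.finite_H
  rw [← avg_map Q.torsion (fun a => a - h) F]
  have : Q.torsion.map (fun a => a - h) = Q.torsion := by
    rw [torsion, Multiset.map_nsmul]
    congr 1
    refine (Multiset.Nodup.ext (Multiset.Nodup.map (sub_left_injective) (Finset.nodup _))
      (Finset.nodup _)).2 fun a => ?_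
    simp only [Multiset.mem_map, Finset.mem_val, Set.Finite.mem_toFinset, SetLike.mem_coe]
    exact ⟨fun ⟨b, hb, e⟩ => e ▸ Q.H.sub_mem hb hh, fun ha => ⟨a + h, Q.H.add_mem ha hh, by simp⟩⟩
  simp [this]

/-- The subgroup contributes no error, and each generator contributes `2 * η / ε`; neither the
subgroup nor the dimensions enter the bound. -/
theorem almostInv_dilate {ε η : ℝ} (hε : 0 < ε) (hη : 0 < η) {q : G} (hq : q ∈ Q.dilate η) :
    AlmostInv (Q.dilate ε) q (Q.rank * (2 * η / ε)) := by
  rw [dilate, sumset, Multiset.mem_map] at hq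
  obtain ⟨⟨h, b⟩, hhb, rfl⟩ := hq
  obtain ⟨h1, h2⟩ := Multiset.mem_product.1 hhb
  obtain ⟨m, hm, rfl⟩ := Multiset.mem_map.1 h2
  have h3 := (almostInv_intBox Q.N_pos hε hη hm).map (φ := fun n => ∑ i, n i • Q.v i)
    fun a b => by simp [sub_smul]
  have h4 := ((Q.almostInv_torsion (Q.mem_torsion.1 h1)).product h3 le_rfl (by positivity)).map
    (φ := fun p : G × G => p.1 + p.2) fun a b => by simp only [Prod.fst_sub, Prod.snd_sub]; abel
  rw [zero_add] at h4
  exact h4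

theorem zero_mem_dilate {ε : ℝ} (hε : 0 < ε) : (0 : G) ∈ Q.dilate ε := by
  rw [dilate, sumset, Multiset.mem_map]
  refine ⟨(0, 0), Multiset.mem_product.2 ⟨Q.mem_torsion.2 Q.H.zero_mem, ?_⟩, by simp⟩
  refine Multiset.mem_map.2 ⟨0, ?_, by simp⟩
  refine Fintype.mem_piFinset.2 fun i => Finset.mem_Icc.2 ?_
  have : 0 ≤ ⌊ε * Q.N i⌋ := Int.floor_nonneg.2 (mul_pos hε (Q.N_pos i)).le
  simpa using this

theorem dilate_ne_zero {ε : ℝ} (hε : 0 < ε) : Q.dilate ε ≠ 0 := fun h => by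
  simpa [h] using Q.zero_mem_dilate hε

end CosetProgression

/-! ### Box norm control of invariant averages. -/

section DualBound

variable {G X K Λ : Type*} [AddCommGroup G] [AddAction G X] [MeasurableSpace X] {μ : Measure X}
  [IsProbabilityMeasure μ] [MeasurableConstVAdd G X] [VAddInvariantMeasure G X μ]
  [AddCommGroup K] [AddCommGroup Λ]

/-- If each `B_c` is unchanged when `λ` and `x` are simultaneously translated by the images of an
element of `K`, and averages over `λ ∈ L` are almost invariant under these translations, then the
averaged correlation of `g` with the products of the `B_c` is controlled by a box norm of `g`. -/
theorem norm_avg_integral_le_boxNorm {D : ℕ} (hD : 0 < D) {P : Fin D → Multiset K}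
    (hP : ∀ c, P c ≠ 0) (σ : K → G) (θ : Fin D → K → Λ) {L : Multiset Λ} {κ : ℝ} (hκ : 0 ≤ κ)
    (hL : ∀ p ∈ piM P, AlmostInv L (∑ c, θ c (p c)) κ)
    {B : Fin D → Λ → X → ℂ} (hB : ∀ c l, Ball (B c l))
    (hinv : ∀ c l t x, B c (l + θ c t) (σ t +ᵥ x) = B c l x) {g : X → ℂ} (hg : Ball g) :
    ‖avg L fun l => ∫ x, g x * ∏ c, B c l x ∂μ‖ ≤ κ + boxNorm μ (fun c => (P c).map σ) g := by
  set F : Λ → ℂ := fun l => ∫ x, g x * ∏ c, B c l x ∂μ with hF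
  have hF1 : ∀ l, ‖F l‖ ≤ 1 := fun l =>
    (hg.mul (Ball.prod _ fun c => hB c l)).norm_integral_le
  -- The parameter is translated by an average over `P`, at a cost of `κ`; the translated average is
  -- then bounded separately for each `l`.
  have e1 : avg L F = (avg (piM P) fun p => avg L F - avg L fun l => F (l - ∑ c, θ c (p c)))
      + avg L fun l => avg (piM P) fun p => F (l - ∑ c, θ c (p c)) := by
    rw [avg_comm L, ← avg_add]
    simp only [sub_add_cancel]
    rw [avg_const (piM_ne_zero hP)]
  rw [e1]
  refine (norm_add_le _ _).trans (add_le_add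
    (norm_avg_le_of_le hκ fun p hp => hL p hp F hF1)
    (norm_avg_le_of_le (by rw [boxNorm]; positivity) fun l _ => ?_))
  rw [le_boxNorm_iff (norm_nonneg _)]
  refine le_trans (le_of_eq ?_) ((box_cauchy_schwarz (μ := μ) hD P σ hg
    (B := fun c p x => B c (l - ∑ c', θ c' (p c')) (-(∑ c', σ (p c')) +ᵥ x))
    (fun c p => (hB _ _).vadd _) ?_).trans (Complex.re_le_norm _))
  · congr 2
    refine avg_congr fun p _ => ?_
    rw [hF]
    simp only
    rw [← integral_vadd (-(∑ c, σ (p c)))]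
  -- Invariance cancels the contribution of `p c` to the `c`-th factor, which is the independence
  -- that Gowers–Cauchy–Schwarz requires.
  · have key : ∀ (c : Fin D) (p : Fin D → K), (fun x => B c (l - ∑ c', θ c' (p c')) (-(∑ c', σ (p c')) +ᵥ x))
        = fun x => B c (l - ∑ c' ∈ Finset.univ.erase c, θ c' (p c'))
            (-(∑ c' ∈ Finset.univ.erase c, σ (p c')) +ᵥ x) := by
      intro c p
      ext x
      rw [← hinv c _ (p c), vadd_vadd, ← Finset.add_sum_erase Finset.univ _ (Finset.mem_univ c),
        ← Finset.add_sum_erase Finset.univ (fun c => σ (p c)) (Finset.mem_univ c)]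
      congr 2 <;> abel
    intro c p p' h
    rw [key, key]
    ext x
    rw [Finset.sum_congr rfl fun c' hc' => by rw [h c' (Finset.ne_of_mem_erase hc')],
      Finset.sum_congr (g := fun c' => σ (p' c')) rfl
        fun c' hc' => by rw [h c' (Finset.ne_of_mem_erase hc')]]

end DualBound


/-! ### Sums of coset progressions, seen through averages. -/

section SumOfProgressions

variable {G : Type*} [AddCommGroup G]

theorem avg_sumset (A B : Multiset G) (F : G → ℂ) :
    avg (sumset A B) F = avg A fun a => avg B fun b => F (a + b) := by
  rw [sumset, avg_map, avg_product]

namespace CosetProgression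

variable (Q R : CosetProgression G)

theorem torsion_ne_zero : Q.torsion ≠ 0 := fun h => by
  simpa [h] using Q.mem_torsion.2 Q.H.zero_mem

theorem avg_torsion_add {h : G} (hh : h ∈ Q.H) (F : G → ℂ) :
    (avg Q.torsion fun a => F (a + h)) = avg Q.torsion F := by
  have := Q.finite_H
  rw [← avg_map Q.torsion (fun a => a + h) F]
  congr 1
  rw [torsion, Multiset.map_nsmul]
  congr 1
  refine (Multiset.Nodup.ext (Multiset.Nodup.map (add_left_injective h) (Finset.nodup _))
    (Finset.nodup _)).2 fun a => ?_
  simp only [Multiset.mem_map, Finset.mem_val, Set.Finite.mem_toFinset, SetLike.mem_coe]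
  exact ⟨fun ⟨b, hb, e⟩ => e ▸ Q.H.add_mem hb hh, fun ha => ⟨a - h, Q.H.sub_mem ha hh, by simp⟩⟩

/-- Both sides are means invariant under translation by the two subgroups, so averaging one over the
other and exchanging the order identifies them without counting multiplicities. -/
theorem avg_torsion_sum (F : G → ℂ) :
    avg (Q + R).torsion F = avg Q.torsion fun a => avg R.torsion fun b => F (a + b) := by
  have h1 : ∀ a ∈ Q.torsion, ∀ b ∈ R.torsion,
      (avg (Q + R).torsion fun z => F (z + (a + b))) = avg (Q + R).torsion F := fun a ha b hb =>
    avg_torsion_add _ (AddSubgroup.add_mem_sup (Q.mem_torsion.1 ha) (R.mem_torsion.1 hb)) F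
  have h2 : ∀ z ∈ (Q + R).torsion,
      (avg Q.torsion fun a => avg R.torsion fun b => F (z + (a + b)))
        = avg Q.torsion fun a => avg R.torsion fun b => F (a + b) := by
    intro z hz
    obtain ⟨y, hy, k, hk, rfl⟩ := AddSubgroup.mem_sup.1 ((Q + R).mem_torsion.1 hz)
    rw [← Q.avg_torsion_add hy fun a => avg R.torsion fun b => F (a + b)]
    refine avg_congr fun a _ => ?_
    rw [← R.avg_torsion_add hk fun b => F (a + y + b)]
    refine avg_congr fun b _ => congrArg F ?_
    abel
  calc avg (Q + R).torsion F
      = avg Q.torsion fun a => avg R.torsion fun b =>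
          avg (Q + R).torsion fun z => F (z + (a + b)) := by
        rw [avg_congr fun a ha => avg_congr fun b hb => h1 a ha b hb,
          avg_const R.torsion_ne_zero, avg_const Q.torsion_ne_zero]
    _ = avg (Q + R).torsion fun z => avg Q.torsion fun a => avg R.torsion fun b =>
          F (z + (a + b)) := by
        simp only [avg_comm R.torsion (Q + R).torsion]
        rw [avg_comm]
    _ = _ := by rw [avg_congr h2, avg_const (torsion_ne_zero _)]

theorem intBox_append {r r' : ℕ} (N : Fin r → ℝ) (N' : Fin r' → ℝ) :
    (intBox (Fin.append N N')).val =
      ((intBox N).val ×ˢ (intBox N').val).map fun p => Fin.append p.1 p.2 := by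
  refine (Multiset.Nodup.ext (Finset.nodup _) (Multiset.Nodup.map ?_
    ((Finset.nodup _).product (Finset.nodup _)))).2 fun m => ?_
  · exact (Fin.appendEquiv r r').injective
  · simp only [Multiset.mem_map, Multiset.mem_product, Finset.mem_val, Prod.exists, intBox,
      Fintype.mem_piFinset]
    constructor
    · intro h
      refine ⟨fun i => m (Fin.castAdd r' i), fun i => m (Fin.natAdd r i),
        ⟨fun i => by simpa using h (Fin.castAdd r' i), fun i => by simpa using h (Fin.natAdd r i)⟩,
        ?_⟩
      exact Fin.append_castAdd_natAdd
    · rintro ⟨a, b, ⟨ha, hb⟩, rfl⟩ i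
      refine Fin.addCases (fun j => ?_) (fun j => ?_) i
      · simpa using ha j
      · simpa using hb j

theorem sum_append_smul {r r' : ℕ} (n : Fin r → ℤ) (m : Fin r' → ℤ) (v : Fin r → G)
    (v' : Fin r' → G) :
    ∑ i, Fin.append n m i • Fin.append v v' i = ∑ i, n i • v i + ∑ i, m i • v' i := by
  simp [Fin.sum_univ_add]

theorem avg_intBox_append {r r' : ℕ} (ε : ℝ) (N : Fin r → ℝ) (N' : Fin r' → ℝ) (v : Fin r → G)
    (v' : Fin r' → G) (E : G → ℂ) :
    (avg (intBox fun i => ε * Fin.append N N' i).val fun n => E (∑ i, n i • Fin.append v v' i))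
      = avg (intBox fun i => ε * N i).val fun n => avg (intBox fun i => ε * N' i).val fun m =>
          E (∑ i, n i • v i + ∑ i, m i • v' i) := by
  have e : (fun i => ε * Fin.append N N' i)
      = Fin.append (fun i => ε * N i) fun i => ε * N' i := by
    funext i
    refine Fin.addCases (fun j => ?_) (fun j => ?_) i <;> simp
  rw [e, intBox_append, avg_map, avg_product]
  simp only [sum_append_smul]

theorem dilate_add_eq (ε : ℝ) : (Q + R).dilate ε = sumset (Q + R).torsion
    ((intBox fun i => ε * Fin.append Q.N R.N i).val.map
      fun n => ∑ i, n i • Fin.append Q.v R.v i) := rfl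

theorem avg_dilate_add (ε : ℝ) (F : G → ℂ) :
    avg ((Q + R).dilate ε) F = avg (sumset (Q.dilate ε) (R.dilate ε)) F := by
  rw [avg_sumset, dilate_add_eq, avg_sumset, avg_torsion_sum]
  simp only [dilate, avg_sumset, avg_map]
  refine avg_congr fun a _ => ?_
  simp only [fun b => avg_intBox_append ε Q.N R.N Q.v R.v fun z => F (a + b + z)]
  rw [avg_comm]
  refine avg_congr fun n _ => avg_congr fun b _ => avg_congr fun m _ => congrArg F ?_
  abel

end CosetProgression

/-- Box norms see multisets only through averages, so the two models of the sum of progressions need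
not be compared as multisets. -/
theorem boxPow_congr_avg {X : Type*} [AddAction G X] [MeasurableSpace X] {μ : Measure X} {d : ℕ}
    {Q Q' : Fin d → Multiset G} (h : ∀ i F, avg (Q i) F = avg (Q' i) F) (f : X → ℂ) :
    boxPow μ d Q f = boxPow μ d Q' f := by
  induction d generalizing f with
  | zero => rfl
  | succ d ih =>
    simp only [boxPow, h, ih fun i => h i.castSucc]

theorem boxNorm_sumFamily {X : Type*} [AddAction G X] [MeasurableSpace X] {μ : Measure X}
    {d₁ d₂ : ℕ} (Q : Fin d₁ → CosetProgression G) (R : Fin d₂ → CosetProgression G) (ε : ℝ)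
    (f : X → ℂ) :
    boxNorm μ (fun k => (sumFamily Q R k).dilate ε) f = boxNorm μ (fun k =>
      sumset ((Q (finProdFinEquiv.symm k).1).dilate ε)
        ((R (finProdFinEquiv.symm k).2).dilate ε)) f := by
  have := boxPow_congr_avg (μ := μ) (Q := fun k => (sumFamily Q R k).dilate ε)
    (Q' := fun k => sumset ((Q (finProdFinEquiv.symm k).1).dilate ε)
      ((R (finProdFinEquiv.symm k).2).dilate ε))
    (fun k F => CosetProgression.avg_dilate_add _ _ ε F) f
  rw [boxNorm, boxNorm, this]

end SumOfProgressions

/-! ### Correlation bounds for products of dual functions. -/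

section DualBounds

variable {G X : Type*} [AddCommGroup G] [AddAction G X] [MeasurableSpace X] {μ : Measure X}
  [IsProbabilityMeasure μ] [MeasurableConstVAdd G X] [VAddInvariantMeasure G X μ]

theorem AlmostInv.piM_single {K : Type*} [AddCommGroup K] {d : ℕ} {A : Fin d → Multiset K}
    {i : Fin d} {q : K} {κ : ℝ} (hκ : 0 ≤ κ) (h : AlmostInv (A i) q κ) :
    AlmostInv (piM A) (Pi.single i q) (d * κ) := by
  refine AlmostInv.pi hκ fun j => ?_
  by_cases hj : j = i
  · subst hj; simpa using h
  · simpa [hj] using (AlmostInv.zero (A j)).mono hκ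

theorem almostInv_piM_dilate {d R : ℕ} {Q : Fin d → CosetProgression G} (hQ : ∀ j, (Q j).rank ≤ R)
    {ε η : ℝ} (hε : 0 < ε) (hη : 0 < η) {i : Fin d} {q : G} (hq : q ∈ (Q i).dilate η) :
    AlmostInv (piM fun j => (Q j).dilate ε) (Pi.single i q) (d * (R * (2 * η / ε))) :=
  AlmostInv.piM_single (A := fun j => (Q j).dilate ε) (by positivity)
    (((Q i).almostInv_dilate hε hη hq).mono (by
      have : ((Q i).rank : ℝ) ≤ R := by exact_mod_cast hQ i
      gcongr))

/-- The product is an average over `n` independent parameter tuples. A translation in direction `j`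
is compensated by moving the `j`-th entry of all `n` tuples at once, which is where the factor `n`
in the error comes from. -/
theorem norm_integral_prod_isDual_le {n d R : ℕ} (hd : 0 < d) {Q : Fin d → CosetProgression G}
    (hQ : ∀ j, (Q j).rank ≤ R) {ε η : ℝ} (hε : 0 < ε) (hη : 0 < η) {φ : Fin n → X → ℂ}
    (hφ : ∀ s, IsDual (fun j => (Q j).dilate ε) (φ s)) {w : X → ℂ} (hw : Ball w) :
    ‖∫ x, (∏ s, φ s x) * w x ∂μ‖ ≤
      d * (n * (d * (R * (2 * η / ε)))) + boxNorm μ (fun j => (Q j).dilate η) w := by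
  choose B hB hinv hφB using hφ
  have key := norm_avg_integral_le_boxNorm (μ := μ) hd (P := fun j => (Q j).dilate η)
    (fun j => (Q j).dilate_ne_zero hη) (fun t : G => t) (fun j t => fun _ : Fin n => Pi.single j t)
    (L := piM fun _ : Fin n => piM fun j => (Q j).dilate ε)
    (κ := d * (n * (d * (R * (2 * η / ε))))) (by positivity) ?_
    (B := fun j l x => ∏ s, B s j (l s) x) (fun j l => Ball.prod _ fun s => hB s j _) ?_ hw
  · simp only [Multiset.map_id'] at key
    refine le_trans (le_of_eq ?_) key
    congr 1
    rw [← integral_avg _ fun l => (hw.mul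
      (Ball.prod Finset.univ fun j => Ball.prod Finset.univ fun s => hB s j _)).integrable]
    congr 1
    ext x
    simp only [hφB]
    rw [← avg_piM_prod, mul_comm, ← avg_mul_left]
    simp only [Finset.prod_comm (s := (Finset.univ : Finset (Fin n)))]
  · intro p hp
    have := AlmostInv.sum (A := piM fun _ : Fin n => piM fun j => (Q j).dilate ε)
      (q := fun j => fun _ : Fin n => Pi.single j (p j)) (κ := n * (d * (R * (2 * η / ε))))
      (fun j => AlmostInv.pi (by positivity) fun s =>
        almostInv_piM_dilate hQ hε hη (mem_of_mem_piM hp j)) Finset.univ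
    simpa using this
  · intro j l t x
    exact Finset.prod_congr rfl fun s _ => hinv s j (l s) t x

theorem norm_avg_integral_cube_isDual_le {d₁ d₂ R : ℕ} (hd₁ : 0 < d₁) (hd₂ : 0 < d₂)
    {Q₁ : Fin d₁ → CosetProgression G} {Q₂ : Fin d₂ → CosetProgression G}
    (hQ₁ : ∀ j, (Q₁ j).rank ≤ R) (hQ₂ : ∀ j, (Q₂ j).rank ≤ R) {ε₁ ε₂ η : ℝ} (hε₁ : 0 < ε₁)
    (hε₂ : 0 < ε₂) (hη : 0 < η) {φ : Fin (numSlots d₁) → X → ℂ}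
    (hφ : ∀ s, IsDual (fun j => (Q₂ j).dilate ε₂) (φ s)) (h : Fin d₁ → G) {g : X → ℂ}
    (hg : Ball g) :
    ‖avg (piM fun i => (Q₁ i).dilate ε₁) fun k =>
        ∫ x, g x * ∏ s, φ s (-(dot (slot s) (k - h)) +ᵥ x) ∂μ‖ ≤
      ↑(d₁ * d₂) * (d₁ * (R * (2 * η / ε₁)) + numSlots d₁ * (d₂ * (R * (2 * η / ε₂)))) +
        boxNorm μ (fun k => (sumFamily Q₁ Q₂ k).dilate η) g := by
  choose B hB hinv hφB using hφ
  rw [boxNorm_sumFamily]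
  -- The directions run over pairs `(q₁, q₂)` and not sums, since the summands act on different
  -- parameters: `q₁` on the `i`-th cube coordinate, `q₂` on the `j`-th entry of every dual tuple.
  -- The group `(i, j)` collects the `j`-th factors of the slots charged to `i`.
  have key := norm_avg_integral_le_boxNorm (μ := μ) (Nat.mul_pos hd₁ hd₂)
    (P := fun c : Fin (d₁ * d₂) => (Q₁ (finProdFinEquiv.symm c).1).dilate η ×ˢ
      (Q₂ (finProdFinEquiv.symm c).2).dilate η) ?_ (fun p : G × G => p.1 + p.2)
    (fun c p => ((Pi.single (finProdFinEquiv.symm c).1 p.1,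
      fun _ : Fin (numSlots d₁) => Pi.single (finProdFinEquiv.symm c).2 p.2) :
        (Fin d₁ → G) × (Fin (numSlots d₁) → Fin d₂ → G)))
    (L := (piM fun i => (Q₁ i).dilate ε₁) ×ˢ piM fun _ : Fin (numSlots d₁) => piM fun j => (Q₂ j).dilate ε₂)
    (κ := ↑(d₁ * d₂) * (d₁ * (R * (2 * η / ε₁)) + numSlots d₁ * (d₂ * (R * (2 * η / ε₂)))))
    (by positivity) ?_
    (B := fun c l x => ∏ s with slotIndex s = (finProdFinEquiv.symm c).1,
      B s (finProdFinEquiv.symm c).2 (l.2 s) (-(dot (slot s) (l.1 - h)) +ᵥ x))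
    (fun j l => Ball.prod _ fun s => (hB s _ _).vadd _) ?_ hg
  · refine le_trans (le_of_eq ?_) key
    rw [avg_product]
    congr 1
    refine avg_congr fun k _ => ?_
    rw [← integral_avg _ fun l => (hg.mul (Ball.prod Finset.univ fun c =>
      Ball.prod _ fun s => (hB s _ _).vadd _)).integrable]
    congr 1
    ext x
    simp only [hφB]
    rw [avg_mul_left, ← avg_piM_prod]
    congr 1
    refine avg_congr fun l _ => ?_
    rw [Fintype.prod_equiv finProdFinEquiv.symm _ (fun c : Fin d₁ × Fin d₂ =>
      ∏ s with slotIndex s = c.1, B s c.2 (l s) (-(dot (slot s) (k - h)) +ᵥ x)) fun _ => rfl,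
      Fintype.prod_prod_type, ← Finset.prod_fiberwise Finset.univ slotIndex]
    exact Finset.prod_congr rfl fun i _ => Finset.prod_comm
  · intro c hc
    have h0 : (0 : G × G) ∈ (Q₁ (finProdFinEquiv.symm c).1).dilate η ×ˢ
      (Q₂ (finProdFinEquiv.symm c).2).dilate η := Multiset.mem_product.2
        ⟨CosetProgression.zero_mem_dilate _ hη, CosetProgression.zero_mem_dilate _ hη⟩
    rw [hc] at h0
    exact Multiset.notMem_zero _ h0
  · intro p hp
    have := AlmostInv.sum
      (A := (piM fun i => (Q₁ i).dilate ε₁) ×ˢ piM fun _ : Fin (numSlots d₁) => piM fun j => (Q₂ j).dilate ε₂)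
      (q := fun c => ((Pi.single (finProdFinEquiv.symm c).1 (p c).1,
        fun _ : Fin (numSlots d₁) => Pi.single (finProdFinEquiv.symm c).2 (p c).2) :
        (Fin d₁ → G) × (Fin (numSlots d₁) → Fin d₂ → G)))
      (κ := d₁ * (R * (2 * η / ε₁)) + numSlots d₁ * (d₂ * (R * (2 * η / ε₂)))) (fun c => by
        have hc := Multiset.mem_product.1 (mem_of_mem_piM hp c)
        exact (almostInv_piM_dilate hQ₁ hε₁ hη hc.1).product
          (AlmostInv.pi (by positivity) fun s => almostInv_piM_dilate hQ₂ hε₂ hη hc.2)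
          (by positivity) (by positivity)) Finset.univ
    simpa using this
  · intro c l t x
    refine Finset.prod_congr rfl fun s hs => ?_
    have hs' : slot s (finProdFinEquiv.symm c).1 = true := by
      rw [← (Finset.mem_filter.1 hs).2]; exact slot_slotIndex s
    rw [← hinv s _ (l.2 s) t.2, vadd_vadd]
    simp only [Prod.fst_add, Prod.snd_add, Pi.add_apply]
    rw [add_sub_right_comm, dot_add, dot_single hs', vadd_vadd]
    congr 2
    abel

end DualBounds


/-! ### Calculus of anti-uniform functions. -/

section AntiUniform

/-- The correlation left after replacing `n` functions with modulus `e` by dual functions. -/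
noncomputable def replBound (e : ℝ → ℝ) (d : ℕ) : ℕ → ℝ → ℝ
  | 0, δ => δ
  | n + 1, δ => e (replBound e d n δ) ^ 2 ^ d

/-- The scale at which `n` functions with modulus `e` can be replaced by dual functions. -/
noncomputable def replScale (e : ℝ → ℝ) (d : ℕ) : ℕ → ℝ → ℝ
  | 0, _ => 1
  | n + 1, δ => min (replScale e d n δ) (e (replBound e d n δ))

/-- A scale `η` below which `C * (2 * η / ε) ≤ δ / 2`. -/
noncomputable def fineScale (C ε δ : ℝ) : ℝ := min (δ / 4) (ε * δ / (4 * (C + 1)))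

/-- A modulus of anti-uniformity for products of `n` functions with modulus `e`. -/
noncomputable def prodMod (e : ℝ → ℝ) (d R n : ℕ) (δ : ℝ) : ℝ :=
  fineScale (d * n * d * R) (replScale e d n δ) (replBound e d n δ)

variable {e e' : ℝ → ℝ} {d : ℕ}

theorem replBound_pos (he : ∀ δ, 0 < δ → 0 < e δ) (n : ℕ) {δ : ℝ} (hδ : 0 < δ) :
    0 < replBound e d n δ := by
  induction n with
  | zero => exact hδ
  | succ n ih => exact pow_pos (he _ ih) _

theorem replScale_pos (he : ∀ δ, 0 < δ → 0 < e δ) (n : ℕ) {δ : ℝ} (hδ : 0 < δ) :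
    0 < replScale e d n δ := by
  induction n with
  | zero => exact one_pos
  | succ n ih => exact lt_min ih (he _ (replBound_pos he n hδ))

theorem fineScale_pos {C ε δ : ℝ} (hC : 0 ≤ C) (hε : 0 < ε) (hδ : 0 < δ) :
    0 < fineScale C ε δ := lt_min (by positivity) (by positivity)

theorem mul_div_le_of_le_fineScale {C ε δ η : ℝ} (hC : 0 ≤ C) (hε : 0 < ε) (hδ : 0 < δ)
    (hη : η ≤ fineScale C ε δ) : C * (2 * η / ε) ≤ δ / 2 := by
  have h1 : η ≤ ε * δ / (4 * (C + 1)) := hη.trans (min_le_right _ _)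
  calc C * (2 * η / ε) ≤ C * (2 * (ε * δ / (4 * (C + 1))) / ε) := by gcongr
    _ = C / (C + 1) * (δ / 2) := by field_simp; ring
    _ ≤ 1 * (δ / 2) := by
        gcongr
        rw [div_le_one (by positivity)]
        linarith
    _ = δ / 2 := one_mul _

theorem prodMod_pos (he : ∀ δ, 0 < δ → 0 < e δ) (R n : ℕ) {δ : ℝ} (hδ : 0 < δ) :
    0 < prodMod e d R n δ :=
  fineScale_pos (by positivity) (replScale_pos he n hδ) (replBound_pos he n hδ)

variable {G X : Type*} [AddCommGroup G] [AddAction G X] [MeasurableSpace X] {μ : Measure X}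
  {Q : Fin d → CosetProgression G}

/-- `u` is anti-uniform along `Q` with modulus `e`: bounded functions having correlation at least
`δ` with `u` have box norms at least `e δ` at all scales `η ≤ e δ`. -/
def AntiUniform (μ : Measure X) (Q : Fin d → CosetProgression G) (e : ℝ → ℝ) (u : X → ℂ) : Prop :=
  Ball u ∧ ∀ δ, 0 < δ → ∀ w, Ball w → δ ≤ ‖∫ x, u x * w x ∂μ‖ →
    ∀ η, 0 < η → η ≤ e δ → e δ ≤ boxNorm μ (fun j => (Q j).dilate η) w

theorem AntiUniform.mono {u : X → ℂ} (h : AntiUniform μ Q e u) (hee : ∀ δ, 0 < δ → e' δ ≤ e δ) :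
    AntiUniform μ Q e' u :=
  ⟨h.1, fun δ hδ w hw hw' η hη hηe =>
    (hee δ hδ).trans (h.2 δ hδ w hw hw' η hη (hηe.trans (hee δ hδ)))⟩

theorem AntiUniform.zero : AntiUniform μ Q e fun _ => 0 :=
  ⟨Ball.const (by simp), fun δ hδ w _ h => by simp at h; linarith⟩

theorem AntiUniform.smul {u : X → ℂ} (h : AntiUniform μ Q e u) {z : ℂ} (hz : ‖z‖ ≤ 1) :
    AntiUniform μ Q e fun x => z * u x := by
  refine ⟨(Ball.const hz).mul h.1, fun δ hδ w hw h' => h.2 δ hδ w hw (h'.trans ?_)⟩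
  simp only [mul_assoc, integral_const_mul, norm_mul]
  exact mul_le_of_le_one_left (norm_nonneg _) hz

theorem AntiUniform.conj {u : X → ℂ} (h : AntiUniform μ Q e u) :
    AntiUniform μ Q e fun x => conj (u x) := by
  refine ⟨h.1.conj, fun δ hδ w hw h' η hη hηe => ?_⟩
  rw [← boxNorm_conj]
  refine h.2 δ hδ _ hw.conj (h'.trans (le_of_eq ?_)) η hη hηe
  rw [← RCLike.norm_conj, ← integral_conj]
  simp

theorem AntiUniform.conjPow {u : X → ℂ} (h : AntiUniform μ Q e u) (n : ℕ) :
    AntiUniform μ Q e fun x => conjPow n (u x) := by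
  induction n generalizing u with
  | zero => exact h
  | succ n ih => exact ih h.conj

/-- A correlation `δ` with the combination forces a correlation at least `δ / K` with `u` or with
`v`. -/
theorem AntiUniform.linearCombination [IsProbabilityMeasure μ] {u v : X → ℂ}
    (hu : AntiUniform μ Q e u) (hv : AntiUniform μ Q e v) {a b : ℂ} {K : ℝ} (hK : 0 < K)
    (hab : ‖a‖ + ‖b‖ ≤ K) (huv : Ball fun x => a * u x + b * v x) :
    AntiUniform μ Q (fun δ => e (δ / K)) fun x => a * u x + b * v x := by
  refine ⟨huv, fun δ hδ w hw h' => ?_⟩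
  have e1 : ∫ x, (a * u x + b * v x) * w x ∂μ
      = a * ∫ x, u x * w x ∂μ + b * ∫ x, v x * w x ∂μ := by
    rw [← integral_const_mul, ← integral_const_mul, ← integral_add
      ((hu.1.mul hw).integrable.const_mul a) ((hv.1.mul hw).integrable.const_mul b)]
    congr 1; ext x; ring
  by_cases h1 : δ / K ≤ ‖∫ x, u x * w x ∂μ‖
  · exact hu.2 _ (by positivity) w hw h1
  by_cases h2 : δ / K ≤ ‖∫ x, v x * w x ∂μ‖
  · exact hv.2 _ (by positivity) w hw h2
  exfalso
  push Not at h1 h2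
  set m := max ‖∫ x, u x * w x ∂μ‖ ‖∫ x, v x * w x ∂μ‖
  have hm : m < δ / K := max_lt h1 h2
  have hm0 : 0 ≤ m := (norm_nonneg _).trans (le_max_left _ _)
  have : δ ≤ K * m := by
    rw [e1] at h'
    calc δ ≤ _ := h'
      _ ≤ _ := norm_add_le _ _
      _ ≤ ‖a‖ * m + ‖b‖ * m := by
        rw [norm_mul, norm_mul]
        gcongr
        · exact le_max_left _ _
        · exact le_max_right _ _
      _ = (‖a‖ + ‖b‖) * m := by ring
      _ ≤ K * m := by gcongr
  rw [lt_div_iff₀ hK] at hm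
  linarith

/-- Some member of the family correlates at least as well as the average, so the modulus does not
deteriorate. -/
theorem AntiUniform.avg [IsProbabilityMeasure μ] {α : Type*} {A : Multiset α} (hA : A ≠ 0)
    {u : α → X → ℂ} (hu : ∀ a, AntiUniform μ Q e (u a)) :
    AntiUniform μ Q e fun x => avg A fun a => u a x := by
  refine ⟨Ball.avg A fun a => (hu a).1, fun δ hδ w hw h' => ?_⟩
  simp only [← avg_mul_right] at h'
  rw [integral_avg _ fun a => ((hu a).1.mul hw).integrable] at h'
  obtain ⟨a, -, ha⟩ := exists_norm_avg_le hA fun a => ∫ x, u a x * w x ∂μ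
  exact (hu a).2 δ hδ w hw (h'.trans ha)

variable [MeasurableConstVAdd G X] [VAddInvariantMeasure G X μ]

theorem boxPow_vadd {d : ℕ} (P : Fin d → Multiset G) (g : G) (f : X → ℂ) :
    boxPow μ d P (fun x => f (g +ᵥ x)) = boxPow μ d P f := by
  induction d generalizing f with
  | zero => exact integral_vadd g f
  | succ d ih =>
    simp only [boxPow]
    refine avg_congr fun a _ => avg_congr fun b _ => ?_
    rw [← ih (fun i => P i.castSucc) (delta a b f)]
    congr 1
    ext x
    simp only [delta, shift, vadd_vadd, add_comm g]

theorem AntiUniform.vadd {u : X → ℂ} (h : AntiUniform μ Q e u) (g : G) :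
    AntiUniform μ Q e fun x => u (g +ᵥ x) := by
  refine ⟨h.1.vadd g, fun δ hδ w hw h' η hη hηe => ?_⟩
  have h2 := h.2 δ hδ _ (hw.vadd (-g)) (h'.trans (le_of_eq ?_)) η hη hηe
  · rwa [boxNorm, boxPow_vadd] at h2
  · rw [← integral_vadd g fun x => u x * w (-g +ᵥ x)]
    simp

variable [IsProbabilityMeasure μ]

/-- In an averaged correlation, anti-uniform functions can be replaced by dual functions. -/
theorem exists_isDual_replacement (he : ∀ δ, 0 < δ → 0 < e δ) {n : ℕ} {δ : ℝ} (hδ : 0 < δ)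
    {u : Fin n → X → ℂ} (hu : ∀ s, AntiUniform μ Q e (u s)) {κ : Type*} (A : Multiset κ)
    (ρ : Fin n → κ → G) {W : κ → X → ℂ} (hW : ∀ k, Ball (W k))
    (h : δ ≤ ‖avg A fun k => ∫ x, W k x * ∏ s, u s (-ρ s k +ᵥ x) ∂μ‖)
    {η : ℝ} (hη : 0 < η) (hηe : η ≤ replScale e d n δ) :
    ∃ φ : Fin n → X → ℂ, (∀ s, IsDual (fun j => (Q j).dilate η) (φ s)) ∧
      replBound e d n δ ≤ ‖avg A fun k => ∫ x, W k x * ∏ s, φ s (-ρ s k +ᵥ x) ∂μ‖ := by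
  induction n generalizing W with
  | zero => exact ⟨u, fun s => s.elim0, by simpa [replBound] using h⟩
  | succ n ih =>
    -- The last anti-uniform factor is absorbed into the weight while induction replaces the others.
    have h1 : δ ≤ ‖avg A fun k => ∫ x, (W k x * u (Fin.last n) (-ρ (Fin.last n) k +ᵥ x)) *
        ∏ s : Fin n, u s.castSucc (-ρ s.castSucc k +ᵥ x) ∂μ‖ := by
      refine h.trans (le_of_eq ?_)
      congr 1
      refine avg_congr fun k _ => ?_
      congr 1
      ext x
      rw [Fin.prod_univ_castSucc]
      ring
    obtain ⟨φ, hφ, hb⟩ := ih (fun s => hu s.castSucc) (fun s => ρ s.castSucc)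
      (fun k => (hW k).mul ((hu _).1.vadd _)) h1 (hηe.trans (min_le_left _ _))
    -- Moving the last factor back to `x` for each `k` isolates it against a single function `V`.
    -- The dual function obtained from `V` is therefore the same for all `k`.
    set V : X → ℂ := fun x => BoxConcat.avg A fun k => W k (ρ (Fin.last n) k +ᵥ x) *
      ∏ s : Fin n, φ s ((-ρ s.castSucc k + ρ (Fin.last n) k) +ᵥ x)
    have hV1 : ∀ k, Ball fun x => W k (ρ (Fin.last n) k +ᵥ x) *
        ∏ s : Fin n, φ s ((-ρ s.castSucc k + ρ (Fin.last n) k) +ᵥ x) := fun k =>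
      ((hW k).vadd _).mul (Ball.prod _ fun s => (hφ s).ball.vadd _)
    have hV : Ball V := Ball.avg A hV1
    have key : ∀ ψ : X → ℂ, Ball ψ → ∫ x, ψ x * V x ∂μ = BoxConcat.avg A fun k =>
        ∫ x, W k x * (∏ s : Fin n, φ s (-ρ s.castSucc k +ᵥ x)) *
          ψ (-ρ (Fin.last n) k +ᵥ x) ∂μ := by
      intro ψ hψ
      simp only [V, ← avg_mul_left]
      rw [integral_avg _ fun k => (hψ.mul (hV1 k)).integrable]
      refine avg_congr fun k _ => ?_
      rw [← integral_vadd (-ρ (Fin.last n) k)]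
      congr 1
      ext x
      simp only [vadd_vadd, add_assoc, add_neg_cancel, add_zero, zero_vadd]
      ring
    have h2 : replBound e d n δ ≤ ‖∫ x, u (Fin.last n) x * V x ∂μ‖ := by
      rw [key _ (hu _).1]
      refine hb.trans (le_of_eq ?_)
      congr 1
      refine avg_congr fun k _ => ?_
      congr 1
      ext x
      ring
    have h3 := (hu (Fin.last n)).2 _ (replBound_pos he n hδ) V hV h2 η hη
      (hηe.trans (min_le_right _ _))
    rw [le_boxNorm_iff (he _ (replBound_pos he n hδ)).le] at h3
    obtain ⟨ψ, hψ, hψV⟩ := exists_isDual (μ := μ) (fun j => (Q j).dilate_ne_zero hη) hV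
    refine ⟨Fin.snoc (α := fun _ => X → ℂ) φ ψ, fun s => ?_, (h3.trans hψV).trans (le_of_eq ?_)⟩
    · refine Fin.lastCases ?_ (fun j => ?_) s
      · simpa using hψ
      · simpa using hφ j
    · rw [key _ hψ.ball]
      congr 1
      refine avg_congr fun k _ => ?_
      congr 1
      ext x
      simp only [Fin.prod_univ_castSucc, Fin.snoc_castSucc, Fin.snoc_last]
      ring

/-- Below `fineScale` the almost-invariance error is at most `δ / 2`, and the box norm has to
account for the rest. -/
theorem le_boxNorm_of_isDual (hd : 0 < d) {R : ℕ} (hQ : ∀ j, (Q j).rank ≤ R) {n : ℕ} {δ ε : ℝ}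
    (hδ : 0 < δ) (hε : 0 < ε) {φ : Fin n → X → ℂ} (hφ : ∀ s, IsDual (fun j => (Q j).dilate ε) (φ s))
    {w : X → ℂ} (hw : Ball w) (h : δ ≤ ‖∫ x, (∏ s, φ s x) * w x ∂μ‖) {η : ℝ} (hη : 0 < η)
    (hη' : η ≤ fineScale (d * n * d * R) ε δ) :
    fineScale (d * n * d * R) ε δ ≤ boxNorm μ (fun j => (Q j).dilate η) w := by
  have h1 := norm_integral_prod_isDual_le (μ := μ) hd hQ hε hη hφ hw
  have h2 := mul_div_le_of_le_fineScale (by positivity) hε hδ hη'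
  have h3 : fineScale (d * n * d * R) ε δ ≤ δ / 4 := min_le_left _ _
  have h4 : (d * (n * (d * (R * (2 * η / ε)))) : ℝ) = d * n * d * R * (2 * η / ε) := by ring
  linarith

theorem AntiUniform.prod (he : ∀ δ, 0 < δ → 0 < e δ) (hd : 0 < d) {R : ℕ}
    (hQ : ∀ j, (Q j).rank ≤ R) {n : ℕ} {u : Fin n → X → ℂ} (hu : ∀ s, AntiUniform μ Q e (u s)) :
    AntiUniform μ Q (prodMod e d R n) fun x => ∏ s, u s x := by
  refine ⟨Ball.prod _ fun s => (hu s).1, fun δ hδ w hw h η hη hηe => ?_⟩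
  -- The averaging set is a single point with zero translations. The scale of the dual functions is
  -- fixed here; `η` is then any finer scale.
  obtain ⟨φ, hφ, hb⟩ := exists_isDual_replacement he hδ hu ({()} : Multiset Unit)
    (fun _ _ => 0) (W := fun _ => w) (fun _ => hw) (by
      rw [avg_const (by simp)]
      simpa [mul_comm] using h) (replScale_pos he n hδ) le_rfl
  rw [avg_const (by simp)] at hb
  exact le_boxNorm_of_isDual hd hQ (replBound_pos he n hδ) (replScale_pos he n hδ) hφ hw
    (by simpa [mul_comm] using hb) hη hηe

/-- Anti-uniformity at a single scale for each `δ` implies anti-uniformity at all small scales. -/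
theorem antiUniform_of_le_boxNorm (he : ∀ δ, 0 < δ → 0 < e δ) (hd : 0 < d) {R : ℕ}
    (hQ : ∀ j, (Q j).rank ≤ R) {u : X → ℂ} (hu : Ball u)
    (h : ∀ δ, 0 < δ → ∀ w, Ball w → δ ≤ ‖∫ x, u x * w x ∂μ‖ →
      e δ ≤ boxNorm μ (fun j => (Q j).dilate (e δ)) w) :
    AntiUniform μ Q (fun δ => fineScale (d * (1 : ℕ) * d * R) (e δ) (e δ ^ 2 ^ d)) u := by
  refine ⟨hu, fun δ hδ w hw h' η hη hηe => ?_⟩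
  have h1 := h δ hδ w hw h'
  rw [le_boxNorm_iff (he δ hδ).le] at h1
  -- The dual function of `w` at the single scale `e δ` detects `w` at all much finer scales.
  obtain ⟨φ, hφ, hb⟩ := exists_isDual (μ := μ) (fun j => (Q j).dilate_ne_zero (he δ hδ)) hw
  exact le_boxNorm_of_isDual hd hQ (pow_pos (he δ hδ) _) (he δ hδ) (φ := fun _ : Fin 1 => φ)
    (fun _ => hφ) hw (by simpa using h1.trans hb) hη hηe

end AntiUniform


/-! ### Energy minimization inside the unit ball. -/

section Energy

/-- Along an increasing sequence of classes, a nonnegative energy almost stabilizes. -/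
theorem exists_almost_minimizer {α : Type*} {S : ℕ → α → Prop} {E : α → ℝ} (hE : ∀ u, 0 ≤ E u)
    {u₀ : α} (hu₀ : S 0 u₀) (hE₀ : E u₀ ≤ 1) {τ : ℝ} {J : ℕ} (hJ : 1 < J * τ) :
    ∃ j < J, ∃ u, S j u ∧ ∀ v, S (j + 1) v → E u - τ ≤ E v := by
  -- Otherwise every class lowers the energy by more than `τ`, and after `J` classes it is negative.
  by_contra! h
  have key : ∀ j ≤ J, ∃ u, S j u ∧ E u ≤ 1 - j * τ := by
    intro j hj
    induction j with
    | zero => exact ⟨u₀, hu₀, by simpa using hE₀⟩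
    | succ j ih =>
      obtain ⟨u, hu, hu'⟩ := ih (by omega)
      obtain ⟨v, hv, hv'⟩ := h j (by omega) u hu
      exact ⟨v, hv, by push_cast; linarith⟩
  obtain ⟨u, -, hu⟩ := key J le_rfl
  linarith [hE u]

/-- Bernoulli for `(2 - s) ^ n`, together with `s * (2 - s) ≤ 1`. -/
theorem pow_mul_one_sub_le {s : ℝ} (hs0 : 0 ≤ s) (hs1 : s ≤ 1) (n : ℕ) :
    s ^ n * (n * (1 - s)) ≤ 1 := by
  have h1 : 1 + (n : ℝ) * (1 - s) ≤ (1 + (1 - s)) ^ n := one_add_mul_le_pow (by linarith) n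
  have h2 : s ^ n * (1 + (1 - s)) ^ n ≤ 1 := by
    rw [← mul_pow]
    exact pow_le_one₀ (by nlinarith) (by nlinarith [sq_nonneg (1 - s)])
  calc s ^ n * (n * (1 - s)) ≤ s ^ n * (1 + (1 - s)) ^ n := by
        gcongr
        linarith
    _ ≤ 1 := h2

/-- Keeps the perturbation of `u` inside the unit ball: Bernoulli gives `1 - s ^ n ≤ n * (1 - s)`,
and `s * (2 - s) ≤ 1`. -/
theorem mul_one_add_le_one {s t : ℝ} (hs0 : 0 ≤ s) (hs1 : s ≤ 1) (ht : 0 ≤ t) {n : ℕ}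
    (htn : t * n ≤ 1) : s * (1 + t * (1 - s ^ n)) ≤ 1 := by
  have h1 : 1 + (n : ℝ) * (s - 1) ≤ (1 + (s - 1)) ^ n := one_add_mul_le_pow (by linarith) n
  have h2 : (1 + (s - 1)) ^ n = s ^ n := by ring_nf
  rw [h2] at h1
  have h3 : t * (1 - s ^ n) ≤ 1 - s := by
    calc t * (1 - s ^ n) ≤ t * (n * (1 - s)) :=
          mul_le_mul_of_nonneg_left (by linarith) ht
      _ = t * n * (1 - s) := by ring
      _ ≤ 1 * (1 - s) := by gcongr
      _ = 1 - s := one_mul _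
  have h4 := mul_le_mul_of_nonneg_left h3 hs0
  nlinarith [sq_nonneg (1 - s)]

variable {X : Type*} [MeasurableSpace X] {μ : Measure X} [IsProbabilityMeasure μ]

theorem integrable_of_norm_le {u : X → ℂ} (hu : Measurable u) {C : ℝ} (h : ∀ x, ‖u x‖ ≤ C) :
    Integrable u μ :=
  Integrable.of_bound hu.aestronglyMeasurable C (ae_of_all _ h)

/-- First-order optimality: expanding the square with `‖D‖ ≤ 2` even gives `5 * t / 2`. -/
theorem re_integral_mul_conj_le {a D : X → ℂ} (ha : Measurable a) (ha2 : ∀ x, ‖a x‖ ≤ 2)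
    (hD : Measurable D) (hD2 : ∀ x, ‖D x‖ ≤ 2) {t : ℝ} (ht : 0 < t)
    (h : (∫ x, ‖a x‖ ^ 2 ∂μ) - t ^ 2 ≤ ∫ x, ‖a x - t * D x‖ ^ 2 ∂μ) :
    (∫ x, a x * conj (D x) ∂μ).re ≤ 3 * t := by
  have hi1 : Integrable (fun x => ‖a x‖ ^ 2) μ :=
    Integrable.of_bound (ha.norm.pow_const 2).aestronglyMeasurable 4 (ae_of_all _ fun x => by
      rw [Real.norm_of_nonneg (by positivity)]; nlinarith [norm_nonneg (a x), ha2 x])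
  have hi2 : Integrable (fun x => ‖D x‖ ^ 2) μ :=
    Integrable.of_bound (hD.norm.pow_const 2).aestronglyMeasurable 4 (ae_of_all _ fun x => by
      rw [Real.norm_of_nonneg (by positivity)]; nlinarith [norm_nonneg (D x), hD2 x])
  have hi3 : Integrable (fun x => a x * conj (D x)) μ :=
    integrable_of_norm_le (ha.mul (Complex.continuous_conj.measurable.comp hD)) (C := 4)
      fun x => by
        rw [norm_mul, RCLike.norm_conj]
        nlinarith [norm_nonneg (D x), hD2 x, norm_nonneg (a x), ha2 x]
  have hi4 : Integrable (fun x => (a x * conj (D x)).re) μ := hi3.re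
  have e1 : ∀ x, ‖a x - t * D x‖ ^ 2
      = ‖a x‖ ^ 2 - 2 * t * (a x * conj (D x)).re + t ^ 2 * ‖D x‖ ^ 2 := by
    intro x
    rw [← Complex.normSq_eq_norm_sq, ← Complex.normSq_eq_norm_sq, ← Complex.normSq_eq_norm_sq,
      Complex.normSq_sub]
    simp only [map_mul, Complex.normSq_ofReal, Complex.conj_ofReal]
    have : a x * (↑t * conj (D x)) = ↑t * (a x * conj (D x)) := by ring
    rw [this, Complex.re_ofReal_mul]
    ring
  have e2 : ∫ x, (a x * conj (D x)).re ∂μ = (∫ x, a x * conj (D x) ∂μ).re := integral_re hi3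
  have e3 : ∫ x, ‖a x - t * D x‖ ^ 2 ∂μ = (∫ x, ‖a x‖ ^ 2 ∂μ)
      - 2 * t * (∫ x, a x * conj (D x) ∂μ).re + t ^ 2 * ∫ x, ‖D x‖ ^ 2 ∂μ := by
    simp only [e1]
    have hs : Integrable (fun x => ‖a x‖ ^ 2 - 2 * t * (a x * conj (D x)).re) μ :=
      hi1.sub (hi4.const_mul _)
    rw [integral_add hs (hi2.const_mul _), integral_sub hi1 (hi4.const_mul _), integral_const_mul,
      integral_const_mul, e2]
  have h4 : ∫ x, ‖D x‖ ^ 2 ∂μ ≤ 4 := by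
    calc ∫ x, ‖D x‖ ^ 2 ∂μ ≤ ∫ _, (4 : ℝ) ∂μ := integral_mono hi2 (integrable_const _)
          fun x => by
            show ‖D x‖ ^ 2 ≤ 4
            nlinarith [norm_nonneg (D x), hD2 x]
      _ = 4 := by simp
  rw [e3] at h
  have h5 : t ^ 2 * ∫ x, ‖D x‖ ^ 2 ∂μ ≤ t ^ 2 * 4 := by gcongr
  have h6 : t * (∫ x, a x * conj (D x) ∂μ).re ≤ t * (3 * t) := by nlinarith
  exact le_of_mul_le_mul_left h6 ht

variable {g u : X → ℂ}

theorem norm_sub_le_two (hg : Ball g) (hu : Ball u) (x : X) : ‖g x - u x‖ ≤ 2 :=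
  (norm_sub_le _ _).trans (by linarith [hg.2 x, hu.2 x])

/-- The perturbation `(1 + t) u` could leave the unit ball, so its increment is damped by `1 -
|u|^(2m)`, which vanishes where `|u| = 1`. The damped part is harmless: `|g| ≤ 1` gives `Re ((g - u)
ū) ≤ |u| (1 - |u|)`, and `|u|^(2m) (1 - |u|)` is of size `1 / m`. -/
theorem re_integral_sub_mul_conj_self_le (hg : Ball g) (hu : Ball u) {m : ℕ} (hm : 0 < m) {t : ℝ}
    (ht : 0 < t) (h : (∫ x, ‖g x - u x‖ ^ 2 ∂μ) - t ^ 2 ≤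
      ∫ x, ‖g x - (u x + t * ((1 - ‖u x‖ ^ (2 * m) : ℝ) * u x))‖ ^ 2 ∂μ) :
    (∫ x, (g x - u x) * conj (u x) ∂μ).re ≤ 3 * t + 1 / m := by
  set D : X → ℂ := fun x => (1 - ‖u x‖ ^ (2 * m) : ℝ) * u x with hD
  have hDm : Measurable D :=
    (Complex.measurable_ofReal.comp (measurable_const.sub (hu.1.norm.pow_const _))).mul hu.1
  have hc : ∀ x, 0 ≤ 1 - ‖u x‖ ^ (2 * m) ∧ 1 - ‖u x‖ ^ (2 * m) ≤ 1 := fun x =>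
    ⟨sub_nonneg.2 (pow_le_one₀ (norm_nonneg _) (hu.2 x)),
      sub_le_self _ (pow_nonneg (norm_nonneg _) _)⟩
  have hD1 : ∀ x, ‖D x‖ ≤ 1 := fun x => by
    rw [hD, norm_mul, Complex.norm_real, Real.norm_of_nonneg (hc x).1]
    exact mul_le_one₀ (hc x).2 (norm_nonneg _) (hu.2 x)
  have hgu : Measurable fun x => g x - u x := hg.1.sub hu.1
  have h1 := re_integral_mul_conj_le (μ := μ) hgu (norm_sub_le_two hg hu) hDm
    (fun x => (hD1 x).trans one_le_two) ht (by simpa only [sub_sub] using h)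
  have hint : ∀ v : X → ℂ, Ball v → Integrable (fun x => (g x - u x) * conj (v x)) μ :=
    fun v hv => integrable_of_norm_le (hgu.mul hv.conj.1) (C := 2) fun x => by
      rw [norm_mul]
      exact (mul_le_of_le_one_right (norm_nonneg _) (hv.conj.2 x)).trans (norm_sub_le_two hg hu x)
  have hiu := hint u hu
  have hiD := hint D ⟨hDm, hD1⟩
  have e1 : ∀ w : X → ℂ, Integrable w μ → (∫ x, w x ∂μ).re = ∫ x, (w x).re ∂μ := fun w hw =>
    (integral_re hw).symm
  rw [e1 _ hiu]
  rw [e1 _ hiD] at h1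
  have hpt : ∀ x, ((g x - u x) * conj (u x)).re ≤ ((g x - u x) * conj (D x)).re + 1 / m := by
    intro x
    set s := ‖u x‖
    have hs0 : 0 ≤ s := norm_nonneg _
    have hs1 : s ≤ 1 := hu.2 x
    set r := ((g x - u x) * conj (u x)).re with hr
    have e2 : ((g x - u x) * conj (D x)).re = (1 - s ^ (2 * m)) * r := by
      rw [hr, ← Complex.re_ofReal_mul, hD, map_mul, Complex.conj_ofReal]
      congr 1
      ring
    have h2 : r ≤ s * (1 - s) := by
      have h3 : r = (g x * conj (u x)).re - s ^ 2 := by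
        rw [hr, sub_mul, Complex.sub_re, Complex.mul_conj, Complex.ofReal_re,
          Complex.normSq_eq_norm_sq]
      have h4 : (g x * conj (u x)).re ≤ s := (Complex.re_le_norm _).trans (by
        rw [norm_mul, RCLike.norm_conj]
        exact mul_le_of_le_one_left (norm_nonneg _) (hg.2 x))
      nlinarith
    have h5 := pow_mul_one_sub_le hs0 hs1 (2 * m)
    have hm' : (0 : ℝ) < m := by exact_mod_cast hm
    have hsp : 0 ≤ s ^ (2 * m) := by positivity
    have h6 : s ^ (2 * m) * r ≤ 1 / m := by
      rw [le_div_iff₀ hm']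
      calc s ^ (2 * m) * r * m ≤ s ^ (2 * m) * (s * (1 - s)) * m := by gcongr
        _ ≤ s ^ (2 * m) * (1 * (1 - s)) * (2 * m) := by
          have : 0 ≤ 1 - s := by linarith
          gcongr
          linarith
        _ = s ^ (2 * m) * (((2 * m : ℕ) : ℝ) * (1 - s)) := by push_cast; ring
        _ ≤ 1 := h5
    rw [e2]
    linarith
  calc ∫ x, ((g x - u x) * conj (u x)).re ∂μ
      ≤ ∫ x, (((g x - u x) * conj (D x)).re + 1 / m) ∂μ :=
        integral_mono hiu.re (hiD.re.add (integrable_const _)) hpt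
    _ = ∫ x, ((g x - u x) * conj (D x)).re ∂μ + 1 / m := by
        have hiD' : Integrable (fun x => ((g x - u x) * conj (D x)).re) μ := hiD.re
        rw [integral_add hiD' (integrable_const _)]
        simp
    _ ≤ _ := by linarith

/-- Moving from `u` towards `z v` stays in the ball and bounds `Re ⟨g - u, z v - u⟩` by `3 * t`; the
term with `u` costs `β`, and `z` aligns the phase. -/
theorem norm_integral_sub_mul_conj_le (hg : Ball g) (hu : Ball u) {β t : ℝ}
    (hβ : (∫ x, (g x - u x) * conj (u x) ∂μ).re ≤ β) (ht : 0 < t) {v : X → ℂ} (hv : Ball v)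
    (h : ∀ z : ℂ, ‖z‖ ≤ 1 → (∫ x, ‖g x - u x‖ ^ 2 ∂μ) - t ^ 2 ≤
      ∫ x, ‖g x - ((1 - t : ℂ) * u x + t * (z * v x))‖ ^ 2 ∂μ) :
    ‖∫ x, (g x - u x) * conj (v x) ∂μ‖ ≤ β + 3 * t := by
  set c := ∫ x, (g x - u x) * conj (v x) ∂μ with hc
  set z : ℂ := c / ‖c‖ with hz
  have hz1 : ‖z‖ ≤ 1 := by
    rw [hz, norm_div, Complex.norm_real, norm_norm]
    exact div_self_le_one _
  have hzv := (Ball.const (X := X) hz1).mul hv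
  have hgu : Measurable fun x => g x - u x := hg.1.sub hu.1
  have hint : ∀ v : X → ℂ, Ball v → Integrable (fun x => (g x - u x) * conj (v x)) μ :=
    fun v hv => integrable_of_norm_le (hgu.mul hv.conj.1) (C := 2) fun x => by
      rw [norm_mul]
      exact (mul_le_of_le_one_right (norm_nonneg _) (hv.conj.2 x)).trans (norm_sub_le_two hg hu x)
  have h1 := re_integral_mul_conj_le (μ := μ) (a := fun x => g x - u x)
    (D := fun x => z * v x - u x) hgu (norm_sub_le_two hg hu)
    (hzv.1.sub hu.1) (norm_sub_le_two hzv hu) ht (by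
      refine (h z hz1).trans (le_of_eq ?_)
      congr 1
      ext x
      congr 2
      ring)
  have e1 : ∫ x, (g x - u x) * conj (z * v x - u x) ∂μ
      = conj z * c - ∫ x, (g x - u x) * conj (u x) ∂μ := by
    rw [hc, ← integral_const_mul, ← integral_sub ((hint v hv).const_mul _) (hint u hu)]
    congr 1
    ext x
    simp only [map_sub, map_mul]
    ring
  have e2 : (conj z * c).re = ‖c‖ := by
    by_cases h0 : c = 0
    · simp [h0]
    · have h0' : (‖c‖ : ℂ) ≠ 0 := by simpa using h0
      have : conj z * c = (‖c‖ : ℂ) := by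
        rw [hz, map_div₀, Complex.conj_ofReal, div_mul_eq_mul_div, mul_comm, Complex.mul_conj,
          Complex.normSq_eq_norm_sq]
        field_simp
        push_cast
        ring
      rw [this, Complex.ofReal_re]
  rw [e1, Complex.sub_re, e2] at h1
  linarith

end Energy

/-! ### The sequence of moduli for the energy argument. -/

section Moduli

/-- A common modulus for the perturbations of functions with modulus `e` used in the energy
argument. -/
noncomputable def stepMod (d R N m : ℕ) (e : ℝ → ℝ) (δ : ℝ) : ℝ :=
  min (min (e δ) (prodMod e d R N δ))
    (min (e (δ / 2)) (prodMod e d R (m + (m + 1)) (δ / 2)))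

/-- The iterates of `stepMod`. -/
noncomputable def modSeq (d R N m : ℕ) (e : ℝ → ℝ) : ℕ → ℝ → ℝ
  | 0 => e
  | j + 1 => stepMod d R N m (modSeq d R N m e j)

variable {d R N m : ℕ} {e : ℝ → ℝ}

theorem modSeq_pos (he : ∀ δ, 0 < δ → 0 < e δ) (j : ℕ) :
    ∀ δ, 0 < δ → 0 < modSeq d R N m e j δ := by
  induction j with
  | zero => exact he
  | succ j ih =>
    intro δ hδ
    exact lt_min (lt_min (ih δ hδ) (prodMod_pos ih R N hδ))
      (lt_min (ih _ (by positivity)) (prodMod_pos ih R _ (by positivity)))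

theorem modSeq_antitone {i j : ℕ} (hij : i ≤ j) (δ : ℝ) :
    modSeq d R N m e j δ ≤ modSeq d R N m e i δ := by
  induction j, hij using Nat.le_induction with
  | base => rfl
  | succ j _ ih => exact ((min_le_left _ _).trans (min_le_left _ _)).trans ih

variable {G X : Type*} [AddCommGroup G] [AddAction G X] [MeasurableSpace X] {μ : Measure X}
  {Q : Fin d → CosetProgression G} [MeasurableConstVAdd G X] [VAddInvariantMeasure G X μ]
  [IsProbabilityMeasure μ] {u v : X → ℂ}

omit [MeasurableConstVAdd G X] [VAddInvariantMeasure G X μ] in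
theorem AntiUniform.convexCombination (hu : AntiUniform μ Q e u)
    (hv : AntiUniform μ Q (fun δ => min (e δ) (prodMod e d R N δ)) v) {t : ℝ} (ht : 0 ≤ t)
    (ht1 : t ≤ 1) {z : ℂ} (hz : ‖z‖ ≤ 1) :
    AntiUniform μ Q (stepMod d R N m e) fun x => (1 - t : ℂ) * u x + t * (z * v x) := by
  have hu' := hu.mono (e' := fun δ => min (e δ) (prodMod e d R N δ)) fun δ _ => min_le_left _ _
  have e1 : ‖(1 - t : ℂ)‖ = 1 - t := by
    rw [← Complex.ofReal_one, ← Complex.ofReal_sub, Complex.norm_real,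
      Real.norm_of_nonneg (by linarith)]
  have e2 : ‖(t : ℂ)‖ = t := by rw [Complex.norm_real, Real.norm_of_nonneg ht]
  have h := hu'.linearCombination (hv.smul hz) (a := (1 - t : ℂ)) (b := t) one_pos
    (by rw [e1, e2]; linarith) ⟨(hu.1.1.const_mul _).add ((hv.smul hz).1.1.const_mul _), fun x => by
      refine (norm_add_le _ _).trans ?_
      rw [norm_mul, norm_mul, e1, e2]
      nlinarith [hu.1.2 x, (hv.smul hz).1.2 x]⟩
  simp only [div_one] at h
  exact h.mono fun δ _ => min_le_left _ _

/-- The function `|u|^(2m) u` is a product of `m` copies of the conjugate of `u` and `m + 1` copies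
of `u`. The coefficients `1 + t` and `-t` have total size at most `2`, hence the `δ / 2` in
`stepMod`. -/
theorem AntiUniform.truncation (he : ∀ δ, 0 < δ → 0 < e δ) (hd : 0 < d)
    (hQ : ∀ j, (Q j).rank ≤ R) (hu : AntiUniform μ Q e u) (hm : 0 < m) {t : ℝ} (ht : 0 ≤ t)
    (htm : t * (2 * m : ℕ) ≤ 1) :
    AntiUniform μ Q (stepMod d R N m e)
      fun x => u x + t * ((1 - ‖u x‖ ^ (2 * m) : ℝ) * u x) := by
  set e' : ℝ → ℝ := fun δ => min (e δ) (prodMod e d R (m + (m + 1)) δ) with he'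
  have hu' := hu.mono (e' := e') fun δ _ => min_le_left _ _
  have h1 := AntiUniform.prod he hd hQ (n := m + (m + 1))
    (u := Fin.append (fun _ x => conj (u x)) fun _ => u) fun s => by
      refine Fin.addCases (fun i => ?_) (fun i => ?_) s
      · simpa using hu.conj
      · simpa using hu
  have e1 : (fun x => ∏ s, Fin.append (fun _ : Fin m => fun x => conj (u x))
      (fun _ : Fin (m + 1) => u) s x) = fun x => ((‖u x‖ ^ (2 * m) : ℝ) : ℂ) * u x := by
    ext x
    simp only [Fin.prod_univ_add, Fin.append_left, Fin.append_right, Finset.prod_const,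
      Finset.card_univ, Fintype.card_fin]
    rw [pow_succ, ← mul_assoc, ← mul_pow, mul_comm (conj (u x)), Complex.mul_conj,
      Complex.normSq_eq_norm_sq, pow_mul]
    push_cast
    ring
  rw [e1] at h1
  have h2 := h1.mono (e' := e') fun δ _ => min_le_right _ _
  have hm1 : (1 : ℝ) ≤ m := by exact_mod_cast hm
  have ht2 : 2 * t ≤ 1 := by push_cast at htm; nlinarith
  have e2 : (fun x => u x + t * ((1 - ‖u x‖ ^ (2 * m) : ℝ) * u x))
      = fun x => (1 + t : ℂ) * u x + (-t : ℂ) * (((‖u x‖ ^ (2 * m) : ℝ) : ℂ) * u x) := by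
    ext x
    push_cast
    ring
  have hball : Ball fun x => (1 + t : ℂ) * u x + (-t : ℂ) * (((‖u x‖ ^ (2 * m) : ℝ) : ℂ) * u x) := by
    refine ⟨(hu.1.1.const_mul _).add (h1.1.1.const_mul _), fun x => ?_⟩
    have e3 : (1 + t : ℂ) * u x + (-t : ℂ) * (((‖u x‖ ^ (2 * m) : ℝ) : ℂ) * u x)
        = ((1 + t * (1 - ‖u x‖ ^ (2 * m)) : ℝ) : ℂ) * u x := by
      push_cast
      ring
    have h3 : 0 ≤ 1 - ‖u x‖ ^ (2 * m) := sub_nonneg.2 (pow_le_one₀ (norm_nonneg _) (hu.1.2 x))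
    refine (congrArg norm e3).trans_le ?_
    rw [norm_mul, Complex.norm_real, Real.norm_of_nonneg (by positivity), mul_comm]
    exact mul_one_add_le_one (norm_nonneg _) (hu.1.2 x) ht htm
  rw [e2]
  have h := hu'.linearCombination h2 (K := 2) two_pos (by
    have e4 : ‖(1 + t : ℂ)‖ = 1 + t := by
      rw [← Complex.ofReal_one, ← Complex.ofReal_add, Complex.norm_real,
        Real.norm_of_nonneg (by linarith)]
    rw [norm_neg, e4, Complex.norm_real, Real.norm_of_nonneg ht]
    linarith) hball
  exact h.mono fun δ _ => min_le_right _ _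

end Moduli


-- The concatenation theorem at a fixed level.

universe u v

/-- The concatenation theorem for functions bounded everywhere, at a fixed level `δ`. -/
theorem exists_scale_lt_boxNorm {d₁ d₂ : ℕ} (hd₁ : 0 < d₁) (hd₂ : 0 < d₂) (R : ℕ) {e₁ e₂ : ℝ → ℝ}
    (he₁ : ∀ δ, 0 < δ → 0 < e₁ δ) (he₂ : ∀ δ, 0 < δ → 0 < e₂ δ) {δ : ℝ} (hδ : 0 < δ) :
    ∃ η₀ : ℝ, 0 < η₀ ∧ ∀ (G : Type u) [AddCommGroup G] (X : Type v) [MeasurableSpace X]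
      (μ : Measure X) [IsProbabilityMeasure μ] [AddAction G X] [MeasurableConstVAdd G X]
      [VAddInvariantMeasure G X μ] (Q₁ : Fin d₁ → CosetProgression G)
      (Q₂ : Fin d₂ → CosetProgression G) (f g : X → ℂ),
      (∀ i, (Q₁ i).rank ≤ R) → (∀ j, (Q₂ j).rank ≤ R) →
      (∀ δ, 0 < δ → ∀ w, Ball w → δ ≤ ‖∫ x, f x * w x ∂μ‖ →
        e₁ δ ≤ boxNorm μ (fun i => (Q₁ i).dilate (e₁ δ)) w) →
      AntiUniform μ Q₂ e₂ f → Ball g → δ ≤ ‖∫ x, f x * conj (g x) ∂μ‖ →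
      ∀ η, 0 < η → η ≤ η₀ → η < boxNorm μ (fun k => (sumFamily Q₁ Q₂ k).dilate η) g := by
  set ε₁ := e₁ (δ / 2)
  have hε₁ : 0 < ε₁ := he₁ _ (by positivity)
  set α := ε₁ ^ 2 ^ d₁
  have hα : 0 < α := pow_pos hε₁ _
  -- Tolerance for correlations with `g - u`: passing between `g` and `u` loses at most half of `δ`
  -- and half of `α`.
  set β := min (δ / 2) (α / 2)
  have hβ : 0 < β := lt_min (by positivity) (by positivity)
  set m := ⌈2 / β⌉₊
  have hm : 0 < m := Nat.ceil_pos.2 (by positivity)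
  have hm0 : (0 : ℝ) < m := by exact_mod_cast hm
  have hmβ : 1 / (m : ℝ) ≤ β / 2 := by
    rw [div_le_iff₀ hm0]
    have := Nat.le_ceil (2 / β)
    rw [div_le_iff₀ hβ] at this
    linarith
  -- The first bound makes `6 * t + 1 / m ≤ β`; the second keeps the damped perturbation in the unit
  -- ball.
  set t := min (β / 12) (1 / (2 * m : ℕ)) with ht_def
  have ht : 0 < t := lt_min (by positivity) (by positivity)
  have ht12 : t ≤ β / 12 := min_le_left _ _
  have htm : t * (2 * m : ℕ) ≤ 1 := by
    have h := min_le_right (β / 12) (1 / ((2 * m : ℕ) : ℝ))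
    rwa [← ht_def, le_div_iff₀ (by positivity)] at h
  have ht1 : t ≤ 1 := by
    have : (1 : ℝ) ≤ m := by exact_mod_cast hm
    push_cast at htm
    nlinarith
  obtain ⟨J, hJ⟩ : ∃ J : ℕ, 1 < J * t ^ 2 := by
    obtain ⟨J, hJ⟩ := exists_nat_gt (1 / t ^ 2)
    exact ⟨J, by rwa [div_lt_iff₀ (by positivity)] at hJ⟩
  set N := numSlots d₁
  set E : ℕ → ℝ → ℝ := modSeq d₂ R N m e₂
  have hE : ∀ j δ, 0 < δ → 0 < E j δ := fun j => modSeq_pos he₂ j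
  -- The stage `j` at which the energy stabilizes depends on the system, so the constants use the
  -- last and smallest modulus `E J`.
  set δ' := replBound (E J) d₂ N (α / 2)
  have hδ' : 0 < δ' := replBound_pos (hE J) N (by positivity)
  set ε₂ := replScale (E J) d₂ N (α / 2)
  have hε₂ : 0 < ε₂ := replScale_pos (hE J) N (by positivity)
  set C : ℝ := ↑(d₁ * d₂) * (d₁ * R + N * (d₂ * R))
  have hC : 0 ≤ C := by positivity
  have hε : 0 < min ε₁ ε₂ := lt_min hε₁ hε₂
  refine ⟨fineScale C (min ε₁ ε₂) δ', fineScale_pos hC hε hδ', ?_⟩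
  intro G _ X _ μ _ _ _ _ Q₁ Q₂ f g hQ₁ hQ₂ hf₁ hf₂ hg hfg η hη hηη
  obtain ⟨j, hj, u, hu, hmin⟩ := exists_almost_minimizer
    (S := fun j u => AntiUniform μ Q₂ (E j) u) (E := fun u => ∫ x, ‖g x - u x‖ ^ 2 ∂μ)
    (fun u => integral_nonneg fun x => sq_nonneg _) (u₀ := fun _ => 0) AntiUniform.zero (by
      simp only [sub_zero]
      calc ∫ x, ‖g x‖ ^ 2 ∂μ ≤ ∫ _, (1 : ℝ) ∂μ := integral_mono_of_nonneg
            (ae_of_all _ fun x => sq_nonneg _) (integrable_const _)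
            (ae_of_all _ fun x => pow_le_one₀ (norm_nonneg _) (hg.2 x))
        _ = 1 := by simp) hJ
  have hself : (∫ x, (g x - u x) * conj (u x) ∂μ).re ≤ 3 * t + 1 / m :=
    re_integral_sub_mul_conj_self_le hg hu.1 hm ht
      (hmin _ (hu.truncation (hE j) hd₂ hQ₂ hm ht.le htm))
  have hclose : ∀ v, AntiUniform μ Q₂ (fun δ => min (E j δ) (prodMod (E j) d₂ R N δ)) v →
      ‖∫ x, (g x - u x) * conj (v x) ∂μ‖ ≤ β := fun v hv =>
    (norm_integral_sub_mul_conj_le hg hu.1 hself ht hv.1 fun z hz =>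
      hmin _ (hu.convexCombination (m := m) hv ht.le ht1 hz)).trans (by linarith)
  have hgu : ∀ v, Ball v → ∫ x, (g x - u x) * v x ∂μ
      = ∫ x, g x * v x ∂μ - ∫ x, u x * v x ∂μ := fun v hv => by
    rw [← integral_sub (hg.mul hv).integrable (hu.1.mul hv).integrable]
    simp only [sub_mul]
  have hfu : δ / 2 ≤ ‖∫ x, f x * conj (u x) ∂μ‖ := by
    have h1 := hclose f (hf₂.mono fun δ _ =>
      (min_le_left _ _).trans (modSeq_antitone (Nat.zero_le j) δ))
    rw [hgu _ hf₂.1.conj] at h1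
    have h2 : ∀ w : X → ℂ, ‖∫ x, w x * conj (f x) ∂μ‖ = ‖∫ x, f x * conj (w x) ∂μ‖ := fun w => by
      rw [← RCLike.norm_conj, ← integral_conj]
      simp [mul_comm]
    have h3 := (norm_sub_norm_le _ _).trans h1
    rw [h2, h2] at h3
    have h4 : β ≤ δ / 2 := min_le_left _ _
    linarith
  have hbox := hf₁ (δ / 2) (by positivity) _ hu.1.conj hfu
  rw [boxNorm_conj, le_boxNorm_iff hε₁.le, boxPow_eq_slots] at hbox
  have hP : ∀ i, (Q₁ i).dilate ε₁ ≠ 0 := fun i => (Q₁ i).dilate_ne_zero hε₁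
  obtain ⟨h, -, hh⟩ := exists_norm_avg_le (piM_ne_zero hP) fun h =>
    avg (piM fun i => (Q₁ i).dilate ε₁) fun l => ∫ x, u x * ∏ s : Fin N,
      conjPow (weight (slot s)) (u (-(dot (slot s) (l - h)) +ᵥ x)) ∂μ
  have huslot : ∀ s : Fin N, AntiUniform μ Q₂ (E j)
      fun x => conjPow (weight (slot s)) (u x) := fun s => hu.conjPow _
  have hprod : ∀ l : Fin d₁ → G, AntiUniform μ Q₂ (prodMod (E j) d₂ R N) fun x =>
      ∏ s : Fin N, conjPow (weight (slot s)) (u (-(dot (slot s) (l - h)) +ᵥ x)) := fun l =>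
    AntiUniform.prod (hE j) hd₂ hQ₂ fun s => (huslot s).vadd _
  set V : X → ℂ := fun x => avg (piM fun i => (Q₁ i).dilate ε₁) fun l =>
    ∏ s : Fin N, conjPow (weight (slot s)) (u (-(dot (slot s) (l - h)) +ᵥ x))
  have hV : AntiUniform μ Q₂ (prodMod (E j) d₂ R N) V := AntiUniform.avg (piM_ne_zero hP) hprod
  have havg : ∀ w, Ball w → ∫ x, w x * V x ∂μ = avg (piM fun i => (Q₁ i).dilate ε₁) fun l =>
      ∫ x, w x * ∏ s : Fin N,
        conjPow (weight (slot s)) (u (-(dot (slot s) (l - h)) +ᵥ x)) ∂μ := fun w hw => by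
    simp only [V, ← avg_mul_left]
    rw [integral_avg _ fun l => (hw.mul (hprod l).1).integrable]
  -- The modulus of `V` is `prodMod (E j)`, and `stepMod` was built to make `g - u` almost
  -- orthogonal to such functions.
  have hgV : α / 2 ≤ ‖∫ x, g x * V x ∂μ‖ := by
    have h1 := hclose (fun x => conj (V x)) (hV.conj.mono fun δ _ => min_le_right _ _)
    simp only [Complex.conj_conj] at h1
    rw [hgu V hV.1, norm_sub_rev] at h1
    have h2 := (norm_sub_norm_le _ _).trans h1
    have h3 : α ≤ ‖∫ x, u x * V x ∂μ‖ := by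
      rw [havg u hu.1]
      exact hbox.trans hh
    have h4 : β ≤ α / 2 := min_le_right _ _
    linarith
  rw [havg g hg] at hgV
  obtain ⟨φ, hφ, hb⟩ := exists_isDual_replacement (hE J) (by positivity : 0 < α / 2)
    (fun s => (huslot s).mono fun δ _ => modSeq_antitone hj.le δ)
    (piM fun i => (Q₁ i).dilate ε₁) (fun s l => dot (slot s) (l - h)) (fun _ => hg) hgV hε₂ le_rfl
  have hfin := norm_avg_integral_cube_isDual_le (μ := μ) hd₁ hd₂ hQ₁ hQ₂ hε₁ hε₂ hη hφ h hg
  have hsmall := mul_div_le_of_le_fineScale hC hε hδ' hηη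
  have hle : (↑(d₁ * d₂) * (d₁ * (R * (2 * η / ε₁)) + N * (d₂ * (R * (2 * η / ε₂)))) : ℝ)
      ≤ C * (2 * η / min ε₁ ε₂) := by
    calc _ ≤ (↑(d₁ * d₂) * (d₁ * (R * (2 * η / min ε₁ ε₂)) +
          N * (d₂ * (R * (2 * η / min ε₁ ε₂)))) : ℝ) := by
          gcongr
          · exact min_le_left _ _
          · exact min_le_right _ _
      _ = _ := by ring
  -- Of the correlation `δ'` at most `δ' / 2` is lost, so the box norm is at least `δ' / 2`, more
  -- than `η`.
  have hη4 : η ≤ δ' / 4 := hηη.trans (min_le_left _ _)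
  linarith

/-! ### From the essential to the pointwise unit ball, and dual norms. -/

section InUnitBall

variable {X : Type*} [MeasurableSpace X] {μ : Measure X}

theorem Ball.inUnitBall {w : X → ℂ} (hw : Ball w) : InUnitBall μ w := by
  refine ⟨hw.1.aestronglyMeasurable, ?_⟩
  rw [eLpNorm_exponent_top]
  simpa using eLpNormEssSup_le_of_ae_bound (μ := μ) (C := 1) (ae_of_all _ hw.2)

theorem InUnitBall.exists_ball {f : X → ℂ} (hf : InUnitBall μ f) : ∃ f', Ball f' ∧ f =ᵐ[μ] f' := by
  obtain ⟨h1, h2⟩ := hf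
  have hm : Measurable (h1.mk f) := h1.stronglyMeasurable_mk.measurable
  refine ⟨fun x => if ‖h1.mk f x‖ ≤ 1 then h1.mk f x else 0,
    ⟨Measurable.ite (measurableSet_le hm.norm measurable_const) hm measurable_const, fun x => ?_⟩, ?_⟩
  · dsimp only
    split_ifs with h
    · exact h
    · simp
  · rw [eLpNorm_exponent_top] at h2
    filter_upwards [h1.ae_eq_mk, ae_le_eLpNormEssSup (f := f) (μ := μ)] with x hx hx'
    have : ‖f x‖ ≤ 1 := by
      have := hx'.trans h2
      rwa [← ofReal_norm, ENNReal.ofReal_le_one] at this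
    rw [← hx, if_pos this]

variable [IsProbabilityMeasure μ]

theorem InUnitBall.norm_integral_le {f g : X → ℂ} (hf : InUnitBall μ f) (hg : InUnitBall μ g) :
    ‖∫ x, f x * conj (g x) ∂μ‖ ≤ 1 := by
  obtain ⟨f', hf', hff⟩ := hf.exists_ball
  obtain ⟨g', hg', hgg⟩ := hg.exists_ball
  rw [integral_congr_ae (g := fun x => f' x * conj (g' x))
    (by filter_upwards [hff, hgg] with x h1 h2; rw [h1, h2])]
  exact (hf'.mul hg'.conj).norm_integral_le

variable {G : Type*} [AddCommGroup G] [AddAction G X]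

theorem norm_integral_le_dualBoxNorm {d : ℕ} {Q : Fin d → CosetProgression G} {ε : ℝ}
    {f g : X → ℂ} (hf : InUnitBall μ f) (hg : InUnitBall μ g)
    (hgε : boxNorm μ (fun i => (Q i).dilate ε) g ≤ ε) :
    ‖∫ x, f x * conj (g x) ∂μ‖ ≤ dualBoxNorm μ Q ε f := by
  refine le_csSup ⟨1, ?_⟩ ⟨g, hg, hgε, rfl⟩
  rintro _ ⟨w, hw, -, rfl⟩
  exact hf.norm_integral_le hw

/-- Contrapositive of the dual norm bound, tested on the conjugate of `w` because anti-uniformity is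
phrased with a bilinear pairing. -/
theorem le_boxNorm_of_dualBoxNorm_lt {d : ℕ} {Q : Fin d → CosetProgression G} {ε δ : ℝ}
    {f f' : X → ℂ} (hf : InUnitBall μ f) (hff : f =ᵐ[μ] f') (h : dualBoxNorm μ Q ε f < δ)
    {w : X → ℂ} (hw : Ball w) (hδ : δ ≤ ‖∫ x, f' x * w x ∂μ‖) :
    ε ≤ boxNorm μ (fun i => (Q i).dilate ε) w := by
  by_contra! hlt
  rw [← boxNorm_conj] at hlt
  have h1 := norm_integral_le_dualBoxNorm hf hw.conj.inUnitBall hlt.le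
  rw [integral_congr_ae (g := fun x => f' x * w x)
    (by filter_upwards [hff] with x hx; simp [hx])] at h1
  linarith

end InUnitBall

end BoxConcat

/-! ### Assembly of the final modulus. -/

theorem theorem1p8 (d₁ d₂ : ℕ) (hd₁ : 0 < d₁) (hd₂ : 0 < d₂)
    (r₁ : Fin d₁ → ℕ) (r₂ : Fin d₂ → ℕ) (c₁ c₂ : ℝ → ℝ)
    (hc₁ : ∀ ε : ℝ, 0 < ε → 0 < c₁ ε) (hc₂ : ∀ ε : ℝ, 0 < ε → 0 < c₂ ε)
    (hc₁_lim : Tendsto c₁ (𝓝[>] 0) (𝓝 0)) (hc₂_lim : Tendsto c₂ (𝓝[>] 0) (𝓝 0)) :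
    ∃ c : ℝ → ℝ, (∀ ε : ℝ, 0 < ε → 0 < c ε) ∧ Tendsto c (𝓝[>] 0) (𝓝 0) ∧
      ∀ (G : Type*) [AddCommGroup G] [Countable G]
        (Q₁ : Fin d₁ → BoxConcat.CosetProgression G) (Q₂ : Fin d₂ → BoxConcat.CosetProgression G)
        (X : Type*) [MeasurableSpace X] (μ : Measure X) [IsProbabilityMeasure μ] [IsSeparable μ]
        [AddAction G X] [MeasurableConstVAdd G X] [VAddInvariantMeasure G X μ] (f : X → ℂ),
        (∀ i, (Q₁ i).rank = r₁ i) → (∀ j, (Q₂ j).rank = r₂ j) →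
        BoxConcat.InUnitBall μ f →
        (∀ ε : ℝ, 0 < ε → BoxConcat.dualBoxNorm μ Q₁ ε f ≤ c₁ ε) →
        (∀ ε : ℝ, 0 < ε → BoxConcat.dualBoxNorm μ Q₂ ε f ≤ c₂ ε) →
        ∀ ε : ℝ, 0 < ε → BoxConcat.dualBoxNorm μ (BoxConcat.sumFamily Q₁ Q₂) ε f ≤ c ε := by
  -- A scale at which the dual norm is below `δ`: correlation at least `δ` then forces the box norm
  -- at that scale to be at least the scale.
  have hmod : ∀ c : ℝ → ℝ, Tendsto c (𝓝[>] 0) (𝓝 0) →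
      ∃ e : ℝ → ℝ, ∀ δ, 0 < δ → 0 < e δ ∧ c (e δ) < δ := by
    intro c hc
    have : ∀ δ, ∃ ε, 0 < δ → 0 < ε ∧ c ε < δ := by
      intro δ
      by_cases hδ : 0 < δ
      · have h1 := hc.eventually (gt_mem_nhds hδ)
        obtain ⟨ε, h2, h3⟩ := (h1.and self_mem_nhdsWithin).exists
        exact ⟨ε, fun _ => ⟨h3, h2⟩⟩
      · exact ⟨0, fun h => absurd h hδ⟩
    choose e he using this
    exact ⟨e, he⟩
  obtain ⟨e₁, he₁⟩ := hmod c₁ hc₁_lim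
  obtain ⟨e₂, he₂⟩ := hmod c₂ hc₂_lim
  set R := ∑ i, r₁ i + ∑ j, r₂ j
  have hr₁ : ∀ i, r₁ i ≤ R := fun i =>
    (Finset.single_le_sum (fun _ _ => Nat.zero_le _) (Finset.mem_univ i)).trans
      (Nat.le_add_right _ _)
  have hr₂ : ∀ j, r₂ j ≤ R := fun j =>
    (Finset.single_le_sum (fun _ _ => Nat.zero_le _) (Finset.mem_univ j)).trans
      (Nat.le_add_left _ _)
  -- The scale is chosen before the group and the system are introduced, which makes the final
  -- modulus uniform.
  have hscale : ∀ δ : ℝ, ∃ η₀ : ℝ, 0 < δ → 0 < η₀ ∧ _ := fun δ => by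
    by_cases hδ : 0 < δ
    · obtain ⟨η₀, h⟩ := BoxConcat.exists_scale_lt_boxNorm hd₁ hd₂ R (fun δ hδ => (he₁ δ hδ).1)
        (e₂ := fun δ => BoxConcat.fineScale (d₂ * (1 : ℕ) * d₂ * R) (e₂ δ) (e₂ δ ^ 2 ^ d₂))
        (fun δ hδ => BoxConcat.fineScale_pos (by positivity) (he₂ δ hδ).1
          (pow_pos (he₂ δ hδ).1 _)) hδ
      exact ⟨η₀, fun _ => h⟩
    · exact ⟨0, fun h => absurd h hδ⟩
  choose η₀ hη₀ using hscale
  -- Levels at which correlation is excluded at scale `ε`. Those with `2 ≤ δ` are trivially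
  -- excluded, correlations being at most `1`, and keep the set nonempty.
  set S : ℝ → Set ℝ := fun ε => {δ | 0 < δ ∧ (ε ≤ η₀ δ ∨ 2 ≤ δ)}
  have hSne : ∀ ε, (S ε).Nonempty := fun ε => ⟨2, two_pos, Or.inr le_rfl⟩
  have hSbdd : ∀ ε, BddBelow (S ε) := fun ε => ⟨0, fun δ hδ => hδ.1.le⟩
  have hS0 : ∀ ε, 0 ≤ sInf (S ε) := fun ε => le_csInf (hSne ε) fun δ hδ => hδ.1.le
  -- The summand `ε` only serves to make the modulus strictly positive.
  refine ⟨fun ε => ε + sInf (S ε), fun ε hε => by have := hS0 ε; positivity, ?_, ?_⟩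
  · rw [Metric.tendsto_nhdsWithin_nhds]
    intro δ hδ
    refine ⟨min (δ / 2) (η₀ (δ / 4)), lt_min (by positivity) (hη₀ _ (by positivity)).1, ?_⟩
    intro ε hε hεδ
    rw [Set.mem_Ioi] at hε
    rw [dist_zero_right, Real.norm_of_nonneg hε.le, lt_min_iff] at hεδ
    have h1 : sInf (S ε) ≤ δ / 4 :=
      csInf_le (hSbdd ε) ⟨by positivity, Or.inl hεδ.2.le⟩
    have h0 := hS0 ε
    rw [dist_zero_right, Real.norm_of_nonneg (by positivity)]
    linarith
  · intro G _ _ Q₁ Q₂ X _ μ _ _ _ _ _ f hrank₁ hrank₂ hf hf₁ hf₂ ε hε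
    have hQ₁ : ∀ i, (Q₁ i).rank ≤ R := fun i => (hrank₁ i).trans_le (hr₁ i)
    have hQ₂ : ∀ j, (Q₂ j).rank ≤ R := fun j => (hrank₂ j).trans_le (hr₂ j)
    obtain ⟨f', hf', hff⟩ := hf.exists_ball
    refine Real.sSup_le ?_ (by have := hS0 ε; positivity)
    rintro _ ⟨g, hg, hgε, rfl⟩
    by_contra! hlt
    obtain ⟨δ, ⟨hδ, hδε⟩, hδlt⟩ := exists_lt_of_csInf_lt (hSne ε) (lt_of_le_of_lt
      (le_add_of_nonneg_left hε.le) hlt)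
    rcases hδε with h | h
    · obtain ⟨g', hg', hgg⟩ := hg.exists_ball
      have h1 := (hη₀ δ hδ).2 G X μ Q₁ Q₂ f' g' hQ₁ hQ₂
        (fun δ hδ w hw hw' => BoxConcat.le_boxNorm_of_dualBoxNorm_lt hf hff
          ((hf₁ _ (he₁ δ hδ).1).trans_lt (he₁ δ hδ).2) hw hw')
        (BoxConcat.antiUniform_of_le_boxNorm (fun δ hδ => (he₂ δ hδ).1) hd₂ hQ₂ hf'
          fun δ hδ w hw hw' => BoxConcat.le_boxNorm_of_dualBoxNorm_lt hf hff
            ((hf₂ _ (he₂ δ hδ).1).trans_lt (he₂ δ hδ).2) hw hw') hg' (by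
          refine hδlt.le.trans (le_of_eq ?_)
          rw [integral_congr_ae (g := fun x => f' x * conj (g' x))
            (by filter_upwards [hff, hgg] with x h1 h2; rw [h1, h2])]) ε hε h
      rw [BoxConcat.boxNorm, BoxConcat.boxPow_congr_ae _ hgg.symm, ← BoxConcat.boxNorm] at h1
      linarith
    · have := hf.norm_integral_le hg
      linarith
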